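/- Let $X=\widehat{\mathbb{Q}^2}$ be the (compact) Pontryagin dual of the discrete group $\mathbb{Q}^2$, equipped with its Haar probability measure, and let $SL_2(\mathbb{Q})$ act on $X$ by $(g\chi)(v)=\chi(g^{-1}v)$ for $g\in SL_2(\mathbb{Q})$, $\chi\in X$, $v\in\mathbb{Q}^2$. Let $Y$ be the quotient of $X$ by the relation $\phi\sim\phi'$, where $\phi'(v)=\phi(-v)$ for all $v\in\mathbb{Q}^2$, with the quotient $\sigma$-algebra and the image $\mu$ of the Haar probability measure. The action of $SL_2(\mathbb{Q})$ descends to $Y$, and since $-\mathrm{id}$ acts trivially on $Y$, it induces a measure preserving action of $\bar G=PSL_2(\mathbb{Q})$ on $(Y,\mu)$. Let $L^\infty(Y)\rtimes\bar G$ be the crossed product von Neumann algebra, that is, the von Neumann algebra on $L^2(Y,\mu)\otimes\ell^2(\bar G)$ generated by the operators $f\otimes 1$ ($f\in L^\infty(Y,\mu)$ acting by multiplication) and the unitaries $u_g=\sigma_g\otimes\lambda_g$ ($g\in\bar G$), where $(\sigma_g\xi)(y)=\xi(g^{-1}y)$ and $\lambda$ is the left regular representation; let $L(\bar G)\subset L^\infty(Y)\rtimes\bar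 G$ be the von Neumann subalgebra generated by $\{u_g: g\in\bar G\}$. Then $L(\bar G)$ is a maximal von Neumann subalgebra of $L^\infty(Y)\rtimes\bar G$: one has $L(\bar G)\subsetneq L^\infty(Y)\rtimes\bar G$, and every von Neumann algebra $P$ with $L(\bar G)\subseteq P\subseteq L^\infty(Y)\rtimes\bar G$ satisfies $P=L(\bar G)$ or $P=L^\infty(Y)\rtimes\bar G$. -/

import Mathlib

open MeasureTheory
open scoped ENNReal MatrixGroups

noncomputable section

/-! ### Von Neumann algebras generated by sets of operators -/

/-- The von Neumann algebra on the Hilbert space `H` generated by a set `S` of bounded operators: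
the bicommutant of `S ∪ star S`. -/
def vonNeumannClosure {H : Type*} [NormedAddCommGroup H] [InnerProductSpace ℂ H] [CompleteSpace H]
    (S : Set (H →L[ℂ] H)) : VonNeumannAlgebra H where
  toStarSubalgebra :=
    StarSubalgebra.centralizer ℂ (StarSubalgebra.centralizer ℂ S : Set (H →L[ℂ] H))
  centralizer_centralizer' := by
    change Set.centralizer (Set.centralizer
      (StarSubalgebra.centralizer ℂ (StarSubalgebra.centralizer ℂ S : Set (H →L[ℂ] H)) :
        Set (H →L[ℂ] H))) =
      (StarSubalgebra.centralizer ℂ (StarSubalgebra.centralizer ℂ S : Set (H →L[ℂ] H)) :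
        Set (H →L[ℂ] H))
    rw [StarSubalgebra.coe_centralizer_centralizer, Set.centralizer_centralizer_centralizer]

/-- `vonNeumannClosure S` is the smallest von Neumann algebra containing `S`. -/
theorem vonNeumannClosure_le_iff {H : Type*} [NormedAddCommGroup H] [InnerProductSpace ℂ H]
    [CompleteSpace H] (S : Set (H →L[ℂ] H)) (N : VonNeumannAlgebra H) :
    vonNeumannClosure S ≤ N ↔ S ⊆ (N : Set (H →L[ℂ] H)) := by
  have hc : ((vonNeumannClosure S : VonNeumannAlgebra H) : Set (H →L[ℂ] H)) =
      Set.centralizer (Set.centralizer (S ∪ star S)) :=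
    StarSubalgebra.coe_centralizer_centralizer ℂ S
  rw [← SetLike.coe_subset_coe, hc]
  constructor
  · intro h
    exact (Set.subset_union_left.trans Set.subset_centralizer_centralizer).trans h
  · intro h
    have h2 : S ∪ star S ⊆ (N : Set (H →L[ℂ] H)) := by
      apply Set.union_subset h
      intro x hx
      have := star_mem (h hx)
      simpa using this
    rw [← N.centralizer_centralizer]
    exact Set.centralizer_subset (Set.centralizer_subset h2)

/-! ### The crossed product of a measure preserving action -/

section CrossedProduct

/-- The Hilbert space `ℓ²(Γ, E)`. -/
abbrev EllTwo (Γ : Type*) (E : Type*) [NormedAddCommGroup E] : Type _ :=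
  lp (fun _ : Γ => E) 2

/-- The bounded operator `ξ ↦ (g ↦ T (ξ (s⁻¹ g)))` on `ℓ²(Γ, E)`, that is `T ⊗ λ_s`. -/
def tensorShift {Γ : Type*} [Group Γ] {E : Type*} [NormedAddCommGroup E] [NormedSpace ℂ E]
    (T : E →L[ℂ] E) (s : Γ) : EllTwo Γ E →L[ℂ] EllTwo Γ E :=
  have hsum : ∀ ξ : EllTwo Γ E, Summable fun g : Γ => ‖ξ (s⁻¹ * g)‖ ^ (2 : ℝ) := fun ξ => by
    have h := (lp.memℓp ξ).summable (by norm_num)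
    rw [show (2 : ℝ≥0∞).toReal = 2 by norm_num] at h
    exact (Equiv.mulLeft s⁻¹).summable_iff.mpr h
  have hle : ∀ (ξ : EllTwo Γ E) (g : Γ),
      ‖T (ξ (s⁻¹ * g))‖ ^ (2 : ℝ) ≤ ‖T‖ ^ (2 : ℝ) * ‖ξ (s⁻¹ * g)‖ ^ (2 : ℝ) := fun ξ g => by
    rw [← Real.mul_rpow (norm_nonneg _) (norm_nonneg _)]
    exact Real.rpow_le_rpow (norm_nonneg _) (T.le_opNorm _) (by norm_num)
  have hmem : ∀ ξ : EllTwo Γ E, Memℓp (fun g : Γ => T (ξ (s⁻¹ * g))) 2 := fun ξ => by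
    refine memℓp_gen ?_
    simpa using Summable.of_nonneg_of_le (fun g => by positivity) (hle ξ) ((hsum ξ).mul_left _)
  LinearMap.mkContinuous
    { toFun := fun ξ => ⟨fun g => T (ξ (s⁻¹ * g)), hmem ξ⟩
      map_add' := fun ξ η => by
        ext1; funext g
        exact T.map_add _ _
      map_smul' := fun c ξ => by
        ext1; funext g
        exact T.map_smul _ _ }
    ‖T‖ fun ξ => by
      refine lp.norm_le_of_tsum_le (by norm_num) (by positivity) ?_
      have h1 : ‖ξ‖ ^ (2 : ℝ) = ∑' g : Γ, ‖ξ (s⁻¹ * g)‖ ^ (2 : ℝ) := by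
        have h := lp.norm_rpow_eq_tsum (p := 2) (by norm_num) ξ
        rw [show (2 : ℝ≥0∞).toReal = 2 by norm_num] at h
        rw [h]
        exact ((Equiv.mulLeft s⁻¹).tsum_eq fun g => ‖ξ g‖ ^ (2 : ℝ)).symm
      rw [show (2 : ℝ≥0∞).toReal = 2 by norm_num,
        Real.mul_rpow (norm_nonneg _) (norm_nonneg _), h1, ← tsum_mul_left]
      exact Summable.tsum_le_tsum (hle ξ)
        (Summable.of_nonneg_of_le (fun g => by positivity) (hle ξ) ((hsum ξ).mul_left _))
        ((hsum ξ).mul_left _)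

@[simp]
theorem tensorShift_apply {Γ : Type*} [Group Γ] {E : Type*} [NormedAddCommGroup E]
    [NormedSpace ℂ E] (T : E →L[ℂ] E) (s : Γ) (ξ : EllTwo Γ E) (g : Γ) :
    tensorShift T s ξ g = T (ξ (s⁻¹ * g)) := rfl

variable {Γ Y : Type*} [Group Γ] [MeasurableSpace Y] [MulAction Γ Y] [MeasurableConstSMul Γ Y]
  (μ : Measure Y) [SMulInvariantMeasure Γ Y μ]

/-- The Koopman operator `σ_s` on `L²(Y, μ)`: `(σ_s f)(y) = f (s⁻¹ y)`. -/
def koopman (s : Γ) : Lp ℂ 2 μ →L[ℂ] Lp ℂ 2 μ :=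
  (Lp.compMeasurePreservingₗᵢ ℂ (fun y : Y => s⁻¹ • y)
    (measurePreserving_smul s⁻¹ μ)).toContinuousLinearMap

/-- The operator of multiplication by `f ∈ L^∞(Y, μ)` on `L²(Y, μ)`. -/
def mulLInfty {Y : Type*} [MeasurableSpace Y] (μ : Measure Y) (f : Lp ℂ ∞ μ) :
    Lp ℂ 2 μ →L[ℂ] Lp ℂ 2 μ :=
  (ContinuousLinearMap.mul ℂ ℂ).holderL μ ∞ 2 2 f

/-- The canonical unitary `u_s = σ_s ⊗ λ_s` on `ℓ²(Γ, L²(Y, μ)) = L²(Y, μ) ⊗ ℓ²(Γ)`: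
`(u_s ξ)(g) = σ_s (ξ (s⁻¹ g))`. -/
def crossedUnitary (s : Γ) : EllTwo Γ (Lp ℂ 2 μ) →L[ℂ] EllTwo Γ (Lp ℂ 2 μ) :=
  tensorShift (koopman μ s) s

/-- The copy `f ⊗ 1` of `f ∈ L^∞(Y, μ)` acting on `ℓ²(Γ, L²(Y, μ))`. -/
def crossedFunction (Γ : Type*) [Group Γ] {Y : Type*} [MeasurableSpace Y] (μ : Measure Y)
    (f : Lp ℂ ∞ μ) : EllTwo Γ (Lp ℂ 2 μ) →L[ℂ] EllTwo Γ (Lp ℂ 2 μ) :=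
  tensorShift (mulLInfty μ f) (1 : Γ)

variable (Γ)

/-- The group von Neumann algebra `L(Γ)`, realised inside the crossed product
`L^∞(Y, μ) ⋊ Γ` as the von Neumann algebra generated by the canonical unitaries. -/
def groupVN : VonNeumannAlgebra (EllTwo Γ (Lp ℂ 2 μ)) :=
  vonNeumannClosure (Set.range fun s : Γ => crossedUnitary μ s)

/-- The crossed product von Neumann algebra `L^∞(Y, μ) ⋊ Γ`, generated on
`L²(Y, μ) ⊗ ℓ²(Γ)` by the functions `f ⊗ 1` and the unitaries `u_s = σ_s ⊗ λ_s`. -/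
def crossedProduct : VonNeumannAlgebra (EllTwo Γ (Lp ℂ 2 μ)) :=
  vonNeumannClosure ((Set.range fun f : Lp ℂ ∞ μ => crossedFunction Γ μ f) ∪
    Set.range fun s : Γ => crossedUnitary μ s)

end CrossedProduct

/-! ### The action of `PSL₂(ℚ)` on the quotient of the dual of `ℚ²` -/

/-- The group `ℚ²`, written multiplicatively and given the discrete topology. -/
def RatSq : Type := Multiplicative (Fin 2 → ℚ)

instance : CommGroup RatSq := inferInstanceAs (CommGroup (Multiplicative (Fin 2 → ℚ)))

instance : TopologicalSpace RatSq := ⊥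

instance : DiscreteTopology RatSq := ⟨rfl⟩

/-- An element of `ℚ²` in additive notation, as an element of `RatSq`. -/
def RatSq.of (v : Fin 2 → ℚ) : RatSq := Multiplicative.ofAdd v

/-- Left multiplication by the matrix `g` on `ℚ²`. -/
def RatSq.mulVec (g : SL(2, ℚ)) : RatSq →ₜ* RatSq where
  toMonoidHom := AddMonoidHom.toMultiplicative (Matrix.mulVecLin g.1).toAddMonoidHom
  continuous_toFun := continuous_of_discreteTopology

/-- The compact group given by the Pontryagin dual of the discrete group `ℚ²`. -/
abbrev DualRatSq : Type := PontryaginDual RatSq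

instance : MeasurableSpace DualRatSq := borel _

instance : BorelSpace DualRatSq := ⟨rfl⟩

/-- The Haar probability measure on the dual of `ℚ²`. -/
def haarDual : Measure DualRatSq := Measure.haarMeasure ⊤

/-- The algebraic action of `SL₂(ℚ)` on the dual of `ℚ²`: `(g χ)(v) = χ (g⁻¹ v)`. -/
instance : MulAction SL(2, ℚ) DualRatSq where
  smul g χ := PontryaginDual.map (RatSq.mulVec g⁻¹) χ
  one_smul χ := by
    refine PontryaginDual.ext fun v => ?_
    change χ (RatSq.mulVec 1⁻¹ v) = χ v
    congr 1
    rw [inv_one]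
    exact Matrix.one_mulVec (Multiplicative.toAdd v)
  mul_smul g h χ := by
    refine PontryaginDual.ext fun v => ?_
    change χ (RatSq.mulVec (g * h)⁻¹ v) = χ (RatSq.mulVec h⁻¹ (RatSq.mulVec g⁻¹ v))
    congr 1
    rw [mul_inv_rev]
    exact (Matrix.mulVec_mulVec (Multiplicative.toAdd v) _ _).symm

theorem smul_dualRatSq_apply (g : SL(2, ℚ)) (χ : DualRatSq) (v : Fin 2 → ℚ) :
    (g • χ) (RatSq.of v) = χ (RatSq.of ((g⁻¹).1.mulVec v)) := rfl

/-- The relation on the dual of `ℚ²` that identifies `φ` with `v ↦ φ (-v)`. -/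
instance pmSetoid : Setoid DualRatSq where
  r φ ψ := ψ = φ ∨ ∀ v : Fin 2 → ℚ, ψ (RatSq.of v) = φ (RatSq.of (-v))
  iseqv :=
    { refl := fun φ => Or.inl rfl
      symm := by
        rintro φ ψ (h | h)
        · exact Or.inl h.symm
        · exact Or.inr fun v => by rw [h (-v), neg_neg]
      trans := by
        rintro φ ψ θ (h | h) (h' | h')
        · exact Or.inl (h'.trans h)
        · exact Or.inr fun v => by rw [h' v, h]
        · exact Or.inr fun v => by rw [h', h v]
        · refine Or.inl (PontryaginDual.ext fun v => ?_)
          have := h' (Multiplicative.toAdd v)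
          rw [h, neg_neg] at this
          exact this }

/-- The quotient `Y` of the dual of `ℚ²` by `φ ∼ φ(-·)`, with the quotient σ-algebra. -/
def DualQuot : Type := Quotient pmSetoid

instance : MeasurableSpace DualQuot := inferInstanceAs (MeasurableSpace (Quotient pmSetoid))

/-- The quotient map onto `Y`. -/
def DualQuot.mk (φ : DualRatSq) : DualQuot := Quotient.mk pmSetoid φ

theorem DualQuot.measurable_mk : Measurable DualQuot.mk := fun _ hs => hs

/-- The probability measure on `Y`, the image of Haar measure. -/
def DualQuot.measure : Measure DualQuot := haarDual.map DualQuot.mk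

/-- The quotient action of `SL₂(ℚ)` on `Y`: `g [φ] = [g φ]`. -/
instance : MulAction SL(2, ℚ) DualQuot where
  smul g := Quotient.map (g • ·) (by
    rintro φ ψ (h | h)
    · exact Or.inl (by rw [h])
    · refine Or.inr fun v => ?_
      simp only [smul_dualRatSq_apply, h, Matrix.mulVec_neg])
  one_smul := by
    rintro ⟨φ⟩
    exact congrArg DualQuot.mk (one_smul _ φ)
  mul_smul := by
    rintro g h ⟨φ⟩
    exact congrArg DualQuot.mk (mul_smul g h φ)

theorem DualQuot.smul_mk (g : SL(2, ℚ)) (φ : DualRatSq) :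
    g • DualQuot.mk φ = DualQuot.mk (g • φ) := rfl

/-- The centre `{±1}` of `SL₂(ℚ)` acts trivially on `Y`. -/
theorem DualQuot.center_smul (g : SL(2, ℚ)) (hg : g ∈ Subgroup.center SL(2, ℚ)) (y : DualQuot) :
    g • y = y := by
  obtain ⟨r, hr, hg⟩ := Matrix.SpecialLinearGroup.mem_center_iff.mp (inv_mem hg)
  obtain ⟨φ⟩ := y
  refine Quotient.sound (Setoid.symm ?_)
  have hmul : ∀ v : Fin 2 → ℚ, (g⁻¹).1.mulVec v = r • v := fun v => by
    rw [← hg]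
    simp
  have hr' : r = 1 ∨ r = -1 := sq_eq_one_iff.mp (by simpa using hr)
  rcases hr' with rfl | rfl
  · refine Or.inl (PontryaginDual.ext fun v => ?_)
    exact congrArg (fun w => φ (RatSq.of w)) ((hmul v).trans (one_smul _ _))
  · refine Or.inr fun v => ?_
    rw [smul_dualRatSq_apply, hmul, neg_smul, one_smul]

/-- The action of `PSL₂(ℚ)` on `Y` as a homomorphism to the permutations of `Y`. -/
def DualQuot.toPerm : PSL(2, ℚ) →* Equiv.Perm DualQuot :=
  QuotientGroup.lift _ (MulAction.toPermHom SL(2, ℚ) DualQuot) fun g hg =>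
    Equiv.ext fun y => DualQuot.center_smul g hg y

/-- The action of `PSL₂(ℚ)` on `Y` induced by the action of `SL₂(ℚ)`. -/
instance : MulAction PSL(2, ℚ) DualQuot := MulAction.compHom DualQuot DualQuot.toPerm

theorem DualQuot.coe_smul (g : SL(2, ℚ)) (y : DualQuot) :
    ((g : PSL(2, ℚ)) • y) = g • y := rfl

theorem measurePreserving_smul_dualRatSq (g : SL(2, ℚ)) :
    MeasurePreserving (fun χ : DualRatSq => g • χ) haarDual haarDual := by
  have : haarDual.IsHaarMeasure := by unfold haarDual; infer_instance
  exact MonoidHom.measurePreserving (μ := haarDual) (ν := haarDual)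
    (f := (PontryaginDual.map (RatSq.mulVec g⁻¹)).toMonoidHom)
    (PontryaginDual.map (RatSq.mulVec g⁻¹)).continuous_toFun
    (MulAction.surjective g) rfl

theorem DualQuot.measurePreserving_smul (g : SL(2, ℚ)) :
    MeasurePreserving (fun y : DualQuot => g • y) DualQuot.measure DualQuot.measure := by
  have hm : Measurable (fun y : DualQuot => g • y) := by
    intro s hs
    exact (measurePreserving_smul_dualRatSq g).measurable (DualQuot.measurable_mk hs)
  refine ⟨hm, ?_⟩
  unfold DualQuot.measure
  rw [Measure.map_map hm DualQuot.measurable_mk]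
  conv_rhs => rw [← (measurePreserving_smul_dualRatSq g).map_eq]
  rw [Measure.map_map DualQuot.measurable_mk (measurePreserving_smul_dualRatSq g).measurable]
  rfl

instance : MeasurableConstSMul PSL(2, ℚ) DualQuot where
  measurable_const_smul g := by
    obtain ⟨g, rfl⟩ := QuotientGroup.mk_surjective g
    exact (DualQuot.measurePreserving_smul g).measurable

instance : SMulInvariantMeasure PSL(2, ℚ) DualQuot DualQuot.measure where
  measure_preimage_smul g s hs := by
    obtain ⟨g, rfl⟩ := QuotientGroup.mk_surjective g
    exact (DualQuot.measurePreserving_smul g).measure_preimage hs.nullMeasurableSet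

end

/-!
Write `Ω = 1 ⊗ δ₁` for the tracial vector and let `P` be an intermediate von Neumann algebra. The
modular conjugation `J` fixes `Ω`, carries `P` into its commutant and preserves the closure of `PΩ`.
Hence `P` is determined by the closure of `PΩ`, and the projection onto it, restricted to
`L²(Y) ⊗ δ₁`, is a map `orbitProj P` which is equivariant under the Koopman representation.

Apply it to the functions `cos v : χ ↦ χ(v) + χ(-v)`, which span `L²(Y)`. Equivariance under the
transvections fixing `v`, together with square summability, forces `orbitProj P (cos v)` to live on
the group elements which are transvections along `v`, and its values to have Fourier coefficients on
the line `ℚv`. As `SL₂(ℚ)` is transitive on nonzero vectors, all of these are recorded by a single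
matrix of numbers `orbitCoeff P a t`. Comparing the two ways of evaluating the trace of
`E(f')* f E(φ) u_g*`, where `E` is the conditional expectation onto `P`, kills the coefficients with
`a ≠ 0` and gives a functional equation for those with `a = 0`, whose only square summable solutions
live on `t = ±1`. So `orbitProj P` acts as a scalar on the orthogonal complement of the constants in
`L²(Y)`; being idempotent, this scalar is `0` or `1`, and these cases give `L(PSL₂(ℚ))` and the
whole crossed product.
-/

open scoped InnerProductSpace ComplexConjugate Matrix

noncomputable section

/-! ### Von Neumann algebras with a tracial vector -/

section Tracial

variable {H : Type*} [NormedAddCommGroup H] [InnerProductSpace ℂ H]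

theorem inner_antilinear_map_map (J : H →ₗᵢ⋆[ℂ] H) (x y : H) : ⟪J x, J y⟫_ℂ = ⟪y, x⟫_ℂ := by
  have norm_add_smul (c : ℂ) : ‖J x + c • J y‖ = ‖x + conj c • y‖ := by
    rw [← J.norm_map (x + _), map_add, map_smulₛₗ, Complex.conj_conj]
  have norm_I_smul (z : H) : ‖x + z‖ = ‖Complex.I • x + Complex.I • z‖ := by
    rw [← smul_add, norm_smul, Complex.norm_I, one_mul]
  have h_add : ‖J x + J y‖ = ‖y + x‖ := by simpa [add_comm] using norm_add_smul 1
  have h_sub : ‖J x - J y‖ = ‖y - x‖ := by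
    simpa [← sub_eq_add_neg, norm_sub_rev y] using norm_add_smul (-1)
  have h_add_I : ‖J x + Complex.I • J y‖ = ‖y + Complex.I • x‖ := by
    rw [norm_add_smul, norm_I_smul, smul_smul, Complex.conj_I, mul_neg, Complex.I_mul_I, neg_neg,
      one_smul, add_comm]
  have h_sub_I : ‖J x - Complex.I • J y‖ = ‖y - Complex.I • x‖ := by
    rw [sub_eq_add_neg, ← neg_smul, norm_add_smul, norm_I_smul, smul_smul, map_neg, Complex.conj_I,
      neg_neg, Complex.I_mul_I, neg_one_smul, ← sub_eq_add_neg, norm_sub_rev]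
  simp only [inner_eq_sum_norm_sq_div_four, RCLike.I_to_complex, h_add, h_sub, h_add_I, h_sub_I]

theorem starProjection_map_comm (K : Submodule ℂ H) [K.HasOrthogonalProjection]
    {F : Type*} [FunLike F H H] [AddMonoidHomClass F H H] (T : F) (hK : ∀ x ∈ K, T x ∈ K)
    (hK' : ∀ x ∈ Kᗮ, T x ∈ Kᗮ) (x : H) : K.starProjection (T x) = T (K.starProjection x) := by
  refine K.eq_starProjection_of_mem_orthogonal (hK _ (K.starProjection_apply_mem x)) ?_
  rw [← map_sub]
  exact hK' _ (K.sub_starProjection_mem_orthogonal x)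

/-- The bounded linear operator `J a J`, for an antilinear isometry `J`. -/
def antilinearConj (J : H →ₗᵢ⋆[ℂ] H) (a : H →L[ℂ] H) : H →L[ℂ] H :=
  J.toContinuousLinearMap.comp (a.comp J.toContinuousLinearMap)

theorem antilinearConj_apply (J : H →ₗᵢ⋆[ℂ] H) (a : H →L[ℂ] H) (ζ : H) :
    antilinearConj J a ζ = J (a (J ζ)) := rfl

variable [CompleteSpace H]

theorem mem_commutant_vonNeumannClosure {S : Set (H →L[ℂ] H)} (hS : ∀ a ∈ S, star a ∈ S)
    {r : H →L[ℂ] H} (hr : ∀ a ∈ S, a * r = r * a) : r ∈ (vonNeumannClosure S).commutant := by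
  rw [VonNeumannAlgebra.mem_commutant_iff]
  intro x hx
  exact (StarSubalgebra.mem_centralizer_iff ℂ).mp hx r
    ((StarSubalgebra.mem_centralizer_iff ℂ).mpr fun a ha => ⟨hr a ha, hr _ (hS a ha)⟩) |>.1.symm

theorem subset_vonNeumannClosure (S : Set (H →L[ℂ] H)) :
    S ⊆ (vonNeumannClosure S : Set (H →L[ℂ] H)) :=
  (vonNeumannClosure_le_iff S _).mp le_rfl

/-- The closed subspace spanned by the vectors `x Ω` with `x ∈ P`. For a tracial vector `Ω` the
orthogonal projection onto it is the conditional expectation onto `P`. -/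
def orbitClosure (P : VonNeumannAlgebra H) (Ω : H) : Submodule ℂ H :=
  (P.toStarSubalgebra.toSubalgebra.toSubmodule.map
    (ContinuousLinearMap.apply ℂ H Ω).toLinearMap).topologicalClosure

namespace orbitClosure

variable {P : VonNeumannAlgebra H} {Ω : H}

theorem apply_mem {x : H →L[ℂ] H} (hx : x ∈ P) : x Ω ∈ orbitClosure P Ω :=
  Submodule.le_topologicalClosure _ ⟨x, hx, rfl⟩

theorem isClosed : IsClosed (orbitClosure P Ω : Set H) :=
  Submodule.isClosed_topologicalClosure _

instance : (orbitClosure P Ω).HasOrthogonalProjection :=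
  have := (isClosed (P := P) (Ω := Ω)).completeSpace_coe
  inferInstance

theorem induction {p : H → Prop} (isClosed : IsClosed {η | p η}) (apply : ∀ x ∈ P, p (x Ω)) {η : H}
    (hη : η ∈ orbitClosure P Ω) : p η := by
  refine closure_minimal (t := {η | p η}) ?_ isClosed hη
  rintro _ ⟨x, hx, rfl⟩
  exact apply x hx

theorem map_mem {x : H →L[ℂ] H} (hx : x ∈ P) {η : H} (hη : η ∈ orbitClosure P Ω) :
    x η ∈ orbitClosure P Ω :=
  induction (p := fun η => x η ∈ orbitClosure P Ω) (isClosed.preimage x.continuous)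
    (fun y hy => apply_mem (x := x * y) (mul_mem hx hy)) hη

theorem starProjection_map {x : H →L[ℂ] H} (hx : x ∈ P) (η : H) :
    (orbitClosure P Ω).starProjection (x η) = x ((orbitClosure P Ω).starProjection η) := by
  refine starProjection_map_comm _ x (fun _ h => map_mem hx h) (fun η hη => ?_) η
  rw [Submodule.mem_orthogonal] at hη ⊢
  intro k hk
  rw [← ContinuousLinearMap.adjoint_inner_left]
  exact hη _ (map_mem (star_mem hx) hk)

end orbitClosure

variable {M : VonNeumannAlgebra H} {J : H →ₗᵢ⋆[ℂ] H} {Ω : H}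

theorem apply_apply_of_mem_commutant {r x : H →L[ℂ] H} (hr : r ∈ M.commutant) (hx : x ∈ M)
    (ζ : H) : x (r ζ) = r (x ζ) :=
  congrArg (fun T : H →L[ℂ] H => T ζ) (VonNeumannAlgebra.mem_commutant_iff.mp hr x hx)

/-- `J` is the modular conjugation of `M` with respect to the tracial vector `Ω`. That `Ω` is
separating for `M` is encoded as cyclicity of `Ω` for the commutant. -/
structure IsModularConjugation (M : VonNeumannAlgebra H) (J : H →ₗᵢ⋆[ℂ] H) (Ω : H) : Prop where
  involutive : ∀ x, J (J x) = x
  map_apply : ∀ a ∈ M, J (a Ω) = (star a) Ω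
  separating : ∀ ζ, (∀ r ∈ M.commutant, ⟪r Ω, ζ⟫_ℂ = 0) → ζ = 0

namespace IsModularConjugation

theorem of_total (hJ : ∀ x, J (J x) = x) (hΩ : J Ω = Ω) (T : Set (H →L[ℂ] H))
    (hTΩ : ∀ a ∈ T, J (a Ω) = (star a) Ω) (hcomm : ∀ a ∈ T, antilinearConj J a ∈ M.commutant)
    (htot : ∀ ζ, (∀ a ∈ T, ⟪a Ω, ζ⟫_ℂ = 0) → ζ = 0) : IsModularConjugation M J Ω where
  involutive := hJ
  separating ζ h := by
    rw [← hJ ζ, htot (J ζ) fun a ha => ?_, map_zero]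
    rw [← hJ (a Ω), inner_antilinear_map_map, ← inner_conj_symm]
    have := h _ (hcomm a ha)
    rw [antilinearConj_apply, hΩ] at this
    rw [this, map_zero]
  map_apply x hx := by
    rw [← hJ ((star x) Ω), sub_eq_zero.mp (htot (x Ω - J (star x Ω)) fun a ha => ?_)]
    rw [inner_sub_right, sub_eq_zero]
    calc ⟪a Ω, x Ω⟫_ℂ = ⟪J (x Ω), J (a Ω)⟫_ℂ := (inner_antilinear_map_map J _ _).symm
      _ = ⟪J (x Ω), star a Ω⟫_ℂ := by rw [hTΩ a ha]
      _ = ⟪a (J (x Ω)), Ω⟫_ℂ := by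
        rw [ContinuousLinearMap.star_eq_adjoint, ContinuousLinearMap.adjoint_inner_right]
      _ = ⟪Ω, antilinearConj J a (x Ω)⟫_ℂ := by
        rw [← inner_antilinear_map_map J, hΩ, antilinearConj_apply]
      _ = ⟪Ω, x (J (a Ω))⟫_ℂ := by
        rw [← apply_apply_of_mem_commutant (hcomm a ha) hx, antilinearConj_apply, hΩ]
      _ = ⟪star x Ω, J (a Ω)⟫_ℂ := by
        rw [ContinuousLinearMap.star_eq_adjoint, ContinuousLinearMap.adjoint_inner_left]
      _ = ⟪a Ω, J (star x Ω)⟫_ℂ := by rw [← inner_antilinear_map_map J, hJ]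

variable {P Q : VonNeumannAlgebra H}

theorem eq_of_forall_inner (h : IsModularConjugation M J Ω) {A B : H →L[ℂ] H}
    (hAB : ∀ r ∈ M.commutant, ∀ r' ∈ M.commutant, ⟪r' Ω, A (r Ω)⟫_ℂ = ⟪r' Ω, B (r Ω)⟫_ℂ) :
    A = B := by
  have adjoint_eq_zero : ContinuousLinearMap.adjoint (A - B) = 0 := by
    ext η
    refine h.separating _ fun r hr => ?_
    have : (A - B) (r Ω) = 0 := h.separating _ fun r' hr' => by
      rw [sub_apply, inner_sub_right, hAB r hr r' hr', sub_self]
    rw [ContinuousLinearMap.adjoint_inner_right, this, inner_zero_left]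
  rw [← sub_eq_zero, ← ContinuousLinearMap.adjoint_adjoint (A - B), adjoint_eq_zero, map_zero]

theorem inner_map_apply_eq (h : IsModularConjugation M J Ω) {y r' : H →L[ℂ] H} (hy : y ∈ M)
    (hr' : r' ∈ M.commutant) (ζ : H) : ⟪r' (J (y Ω)), ζ⟫_ℂ = ⟪r' Ω, y ζ⟫_ℂ := by
  rw [h.map_apply y hy, ← apply_apply_of_mem_commutant hr' (star_mem hy),
    ContinuousLinearMap.star_eq_adjoint, ContinuousLinearMap.adjoint_inner_left]

theorem mem_of_apply_mem (h : IsModularConjugation M J Ω) (hP : P ≤ M) {x : H →L[ℂ] H}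
    (hx : x ∈ M) (hxP : x Ω ∈ orbitClosure P Ω) : x ∈ P := by
  rw [← SetLike.mem_coe, ← P.centralizer_centralizer]
  intro c hc
  refine h.eq_of_forall_inner fun r hr r' hr' => ?_
  -- `c` commutes with `y ∈ P`, hence with `x`, in a form involving only the vectors `y Ω`, `x Ω`.
  have inner_eq : ⟪r' (J (x Ω)), c (r Ω)⟫_ℂ = ⟪r' Ω, c (r (x Ω))⟫_ℂ := by
    refine orbitClosure.induction
      (p := fun η => ⟪r' (J η), c (r Ω)⟫_ℂ = ⟪r' Ω, c (r η)⟫_ℂ) ?_ (fun y hy => ?_) hxP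
    · have := J.continuous
      exact isClosed_eq (by fun_prop) (by fun_prop)
    · rw [h.inner_map_apply_eq (hP hy) hr', ← apply_apply_of_mem_commutant hr (hP hy)]
      exact congrArg (fun T : H →L[ℂ] H => ⟪r' Ω, T (r Ω)⟫_ℂ) (hc y hy)
  rw [h.inner_map_apply_eq hx hr', ← apply_apply_of_mem_commutant hr hx] at inner_eq
  exact inner_eq.symm

theorem le_of_orbitClosure_le (h : IsModularConjugation M J Ω) (hP : P ≤ M) (hQ : Q ≤ M)
    (hPQ : orbitClosure P Ω ≤ orbitClosure Q Ω) : P ≤ Q :=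
  fun _ hx => h.mem_of_apply_mem hQ (hP hx) (hPQ (orbitClosure.apply_mem hx))

theorem map_mem_orbitClosure (h : IsModularConjugation M J Ω) (hP : P ≤ M) {η : H}
    (hη : η ∈ orbitClosure P Ω) : J η ∈ orbitClosure P Ω := by
  refine orbitClosure.induction (p := fun η => J η ∈ orbitClosure P Ω)
    (orbitClosure.isClosed.preimage J.continuous) (fun x hx => ?_) hη
  rw [h.map_apply x (hP hx)]
  exact orbitClosure.apply_mem (star_mem hx)

theorem starProjection_map (h : IsModularConjugation M J Ω) (hP : P ≤ M) (η : H) :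
    (orbitClosure P Ω).starProjection (J η) = J ((orbitClosure P Ω).starProjection η) := by
  refine starProjection_map_comm _ J (fun _ hη => h.map_mem_orbitClosure hP hη) (fun η hη => ?_) η
  rw [Submodule.mem_orthogonal] at hη ⊢
  intro k hk
  rw [← h.involutive k, inner_antilinear_map_map, ← inner_conj_symm,
    hη _ (h.map_mem_orbitClosure hP hk), map_zero]

theorem antilinearConj_star_apply (h : IsModularConjugation M J Ω) {x y : H →L[ℂ] H} (hx : x ∈ M)
    (hy : y ∈ M) : antilinearConj J (star x) (y Ω) = y (x Ω) := by
  have := h.map_apply (y * x) (mul_mem hy hx)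
  rw [star_mul] at this
  rw [antilinearConj_apply, h.map_apply y hy, ← h.involutive (y (x Ω))]
  exact congrArg J this.symm

theorem inner_antilinearConj_star (h : IsModularConjugation M J Ω) (x : H →L[ℂ] H) (η ζ : H) :
    ⟪η, antilinearConj J (star x) ζ⟫_ℂ = ⟪antilinearConj J x η, ζ⟫_ℂ := by
  rw [antilinearConj_apply, antilinearConj_apply, ← inner_antilinear_map_map J, h.involutive,
    ContinuousLinearMap.star_eq_adjoint, ContinuousLinearMap.adjoint_inner_left,
    ← inner_antilinear_map_map J (x (J η)) (J ζ),
    h.involutive]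

theorem starProjection_antilinearConj (h : IsModularConjugation M J Ω) (hP : P ≤ M)
    {x : H →L[ℂ] H} (hx : x ∈ P) (η : H) :
    (orbitClosure P Ω).starProjection (antilinearConj J x η) =
      antilinearConj J x ((orbitClosure P Ω).starProjection η) := by
  simp only [antilinearConj_apply, h.starProjection_map hP, orbitClosure.starProjection_map hx]

/-- With `E` the conditional expectation onto `P` and `η = x Ω`, `x ∈ P`, both sides are the trace
of `E(b)* f x`. -/
theorem inner_starProjection (h : IsModularConjugation M J Ω) (hP : P ≤ M) {b f : H →L[ℂ] H}
    (hb : b ∈ M) (hf : f ∈ M) {η : H} (hη : η ∈ orbitClosure P Ω) :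
    ⟪(orbitClosure P Ω).starProjection (b Ω), f η⟫_ℂ =
      ⟪b (J η), (orbitClosure P Ω).starProjection (f Ω)⟫_ℂ := by
  refine orbitClosure.induction
    (p := fun η => ⟪(orbitClosure P Ω).starProjection (b Ω), f η⟫_ℂ =
      ⟪b (J η), (orbitClosure P Ω).starProjection (f Ω)⟫_ℂ) ?_ (fun x hx => ?_) hη
  · have := J.continuous
    exact isClosed_eq (by fun_prop) (by fun_prop)
  set e := (orbitClosure P Ω).starProjection
  calc ⟪e (b Ω), f (x Ω)⟫_ℂ = ⟪e (b Ω), antilinearConj J (star x) (f Ω)⟫_ℂ := by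
        rw [h.antilinearConj_star_apply (hP hx) hf]
    _ = ⟪b Ω, antilinearConj J (star x) (e (f Ω))⟫_ℂ := by
        rw [Submodule.inner_starProjection_left_eq_right,
          h.starProjection_antilinearConj hP (star_mem hx)]
    _ = ⟪antilinearConj J x (b Ω), e (f Ω)⟫_ℂ := h.inner_antilinearConj_star x _ _
    _ = ⟪b (J (x Ω)), e (f Ω)⟫_ℂ := by
        rw [h.map_apply x (hP hx), ← h.antilinearConj_star_apply (star_mem (hP hx)) hb, star_star]

end IsModularConjugation

end Tracial

/-! ### The tracial vector of a crossed product -/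

section LpConj

variable {Y : Type*} [MeasurableSpace Y] {μ : Measure Y}

/-- Complex conjugation on `L²(Y, μ)`. -/
def conjLTwo (μ : Measure Y) : Lp ℂ 2 μ →ₗᵢ⋆[ℂ] Lp ℂ 2 μ where
  toFun φ := star φ
  map_add' φ ψ := by
    apply Lp.ext
    filter_upwards [Lp.coeFn_star (φ + ψ), Lp.coeFn_star φ, Lp.coeFn_star ψ, Lp.coeFn_add φ ψ,
      Lp.coeFn_add (star φ) (star ψ)] with y h1 h2 h3 h4 h5
    rw [h1, h5, Pi.star_apply, h4, Pi.add_apply, Pi.add_apply, h2, h3, star_add]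
    rfl
  map_smul' c φ := by
    apply Lp.ext
    filter_upwards [Lp.coeFn_star (c • φ), Lp.coeFn_star φ, Lp.coeFn_smul c φ,
      Lp.coeFn_smul (conj c) (star φ)] with y h1 h2 h3 h4
    simp [h1, h2, h3, h4]
  norm_map' φ := by
    rw [Lp.norm_def, Lp.norm_def]
    refine congrArg ENNReal.toReal (eLpNorm_congr_norm_ae ?_)
    filter_upwards [Lp.coeFn_star φ] with y h
    simp [h]

theorem coeFn_conjLTwo (φ : Lp ℂ 2 μ) : conjLTwo μ φ =ᵐ[μ] fun y => conj (φ y) :=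
  Lp.coeFn_star φ

theorem conjLTwo_conjLTwo (φ : Lp ℂ 2 μ) : conjLTwo μ (conjLTwo μ φ) = φ :=
  star_star φ

theorem coeFn_mulLInfty (f : Lp ℂ ∞ μ) (φ : Lp ℂ 2 μ) :
    mulLInfty μ f φ =ᵐ[μ] fun y => f y * φ y :=
  (ContinuousLinearMap.mul ℂ ℂ).coeFn_holder f φ

theorem mulLInfty_comm (f f' : Lp ℂ ∞ μ) (φ : Lp ℂ 2 μ) :
    mulLInfty μ f (mulLInfty μ f' φ) = mulLInfty μ f' (mulLInfty μ f φ) := by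
  apply Lp.ext
  filter_upwards [coeFn_mulLInfty f (mulLInfty μ f' φ), coeFn_mulLInfty f' (mulLInfty μ f φ),
    coeFn_mulLInfty f φ, coeFn_mulLInfty f' φ] with y h1 h2 h3 h4
  rw [h1, h2, h3, h4, mul_left_comm]

theorem conjLTwo_mulLInfty (f : Lp ℂ ∞ μ) (φ : Lp ℂ 2 μ) :
    conjLTwo μ (mulLInfty μ f φ) = mulLInfty μ (star f) (conjLTwo μ φ) := by
  apply Lp.ext
  filter_upwards [coeFn_mulLInfty f φ, coeFn_mulLInfty (star f) (conjLTwo μ φ),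
    coeFn_conjLTwo φ, coeFn_conjLTwo (mulLInfty μ f φ), Lp.coeFn_star f] with y h1 h2 h3 h4 h5
  simp [h1, h2, h3, h4, h5]

theorem star_mulLInfty (f : Lp ℂ ∞ μ) : star (mulLInfty μ f) = mulLInfty μ (star f) := by
  rw [ContinuousLinearMap.star_eq_adjoint, eq_comm, ContinuousLinearMap.eq_adjoint_iff]
  intro φ ψ
  rw [L2.inner_def, L2.inner_def]
  refine integral_congr_ae ?_
  filter_upwards [coeFn_mulLInfty (star f) φ, coeFn_mulLInfty f ψ, Lp.coeFn_star f] with y h1 h2 h3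
  simp only [h1, h2, h3, RCLike.inner_apply, map_mul, Pi.star_apply, RCLike.star_def,
    Complex.conj_conj, mul_assoc, mul_left_comm]

theorem mulLInfty_indicator [IsFiniteMeasure μ] {s : Set Y} (hs : MeasurableSet s) :
    mulLInfty μ (indicatorConstLp ∞ hs (measure_ne_top μ s) (1 : ℂ)) (Lp.const 2 μ (1 : ℂ)) =
      indicatorConstLp 2 hs (measure_ne_top μ s) (1 : ℂ) := by
  apply Lp.ext
  filter_upwards [coeFn_mulLInfty (indicatorConstLp ∞ hs (measure_ne_top μ s) (1 : ℂ))
    (Lp.const 2 μ (1 : ℂ)), indicatorConstLp_coeFn (p := ∞) (hs := hs)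
    (hμs := measure_ne_top μ s) (c := (1 : ℂ)), indicatorConstLp_coeFn (p := 2) (hs := hs)
    (hμs := measure_ne_top μ s) (c := (1 : ℂ)), Lp.coeFn_const 2 μ (1 : ℂ)] with y h1 h2 h3 h4
  rw [h1, h2, h3, h4]; simp

theorem eq_zero_of_forall_inner_mulLInfty [IsFiniteMeasure μ] {φ : Lp ℂ 2 μ}
    (h : ∀ f : Lp ℂ ∞ μ, ⟪mulLInfty μ f (Lp.const 2 μ (1 : ℂ)), φ⟫_ℂ = 0) : φ = 0 := by
  rw [Lp.eq_zero_iff_ae_eq_zero]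
  refine Lp.ae_eq_zero_of_forall_setIntegral_eq_zero φ (by norm_num) (by norm_num)
    (fun s _ _ => ((Lp.memLp φ).integrable (by norm_num)).integrableOn) fun s hs _ => ?_
  have := h (indicatorConstLp ∞ hs (measure_ne_top μ s) (1 : ℂ))
  rwa [mulLInfty_indicator, L2.inner_indicatorConstLp_one] at this

theorem conjLTwo_const_one [IsFiniteMeasure μ] :
    conjLTwo μ (Lp.const 2 μ (1 : ℂ)) = Lp.const 2 μ (1 : ℂ) := by
  apply Lp.ext
  filter_upwards [coeFn_conjLTwo (Lp.const 2 μ (1 : ℂ)), Lp.coeFn_const 2 μ (1 : ℂ)] with y h1 h2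
  rw [h1, h2]; simp

end LpConj

section DeltaTensor

variable {Γ E : Type*} [NormedAddCommGroup E] [InnerProductSpace ℂ E]

open Classical in
/-- The isometric embedding `φ ↦ δ_g ⊗ φ` of `E` in `ℓ²(Γ, E)`. -/
def deltaTensor (g : Γ) : E →L[ℂ] EllTwo Γ E :=
  lp.singleContinuousLinearMap ℂ (fun _ => E) 2 g

theorem deltaTensor_self (g : Γ) (φ : E) : deltaTensor g φ g = φ := by
  simp [deltaTensor]

theorem deltaTensor_of_ne {g k : Γ} (h : k ≠ g) (φ : E) : deltaTensor g φ k = 0 := by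
  simp [deltaTensor, h]

theorem hasSum_deltaTensor (ξ : EllTwo Γ E) : HasSum (fun g => deltaTensor g (ξ g)) ξ := by
  classical
  convert lp.hasSum_single (by norm_num) ξ
  rw [deltaTensor, lp.singleContinuousLinearMap_apply]

theorem inner_deltaTensor_left (g : Γ) (φ : E) (ξ : EllTwo Γ E) :
    ⟪deltaTensor g φ, ξ⟫_ℂ = ⟪φ, ξ g⟫_ℂ := by
  classical exact lp.inner_single_left (𝕜 := ℂ) g φ ξ

variable [Group Γ]

theorem tensorShift_deltaTensor (T : E →L[ℂ] E) (s g : Γ) (φ : E) :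
    tensorShift T s (deltaTensor g φ) = deltaTensor (s * g) (T φ) := by
  ext1; funext k
  rw [tensorShift_apply]
  by_cases h : k = s * g
  · rw [h, inv_mul_cancel_left, deltaTensor_self, deltaTensor_self]
  · rw [deltaTensor_of_ne h, deltaTensor_of_ne (mt inv_mul_eq_iff_eq_mul.mp h), map_zero]

theorem star_tensorShift [CompleteSpace E] (T : E →L[ℂ] E) (s : Γ) :
    star (tensorShift T s) = tensorShift (star T) s⁻¹ := by
  rw [ContinuousLinearMap.star_eq_adjoint, eq_comm, ContinuousLinearMap.eq_adjoint_iff]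
  intro ξ η
  have inner_apply (g : Γ) : ⟪tensorShift (star T) s⁻¹ ξ g, η g⟫_ℂ =
      ⟪ξ (s * g), tensorShift T s η (s * g)⟫_ℂ := by
    rw [tensorShift_apply, tensorShift_apply, inv_inv, inv_mul_cancel_left,
      ContinuousLinearMap.star_eq_adjoint, ContinuousLinearMap.adjoint_inner_left]
  rw [lp.inner_eq_tsum, lp.inner_eq_tsum, tsum_congr inner_apply]
  exact (Equiv.mulLeft s).tsum_eq fun g => ⟪ξ g, tensorShift T s η g⟫_ℂ

end DeltaTensor

section CrossedFunction

variable {Γ Y : Type*} [Group Γ] [MeasurableSpace Y] {μ : Measure Y}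

theorem crossedFunction_apply (f : Lp ℂ ∞ μ) (g : Γ) (ξ : EllTwo Γ (Lp ℂ 2 μ)) :
    crossedFunction Γ μ f ξ g = mulLInfty μ f (ξ g) := by
  rw [crossedFunction, tensorShift_apply, inv_one, one_mul]

theorem star_crossedFunction (f : Lp ℂ ∞ μ) :
    star (crossedFunction Γ μ f) = crossedFunction Γ μ (star f) := by
  rw [crossedFunction, star_tensorShift, star_mulLInfty, inv_one, crossedFunction]

theorem crossedFunction_deltaTensor (f : Lp ℂ ∞ μ) (g : Γ) (φ : Lp ℂ 2 μ) :
    crossedFunction Γ μ f (deltaTensor g φ) = deltaTensor g (mulLInfty μ f φ) := by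
  rw [crossedFunction, tensorShift_deltaTensor, one_mul]

variable (Γ μ) in
/-- The canonical tracial vector `δ₁ ⊗ 1` of a crossed product. -/
def crossedVector [IsFiniteMeasure μ] : EllTwo Γ (Lp ℂ 2 μ) :=
  deltaTensor (1 : Γ) (Lp.const 2 μ (1 : ℂ))

theorem crossedFunction_crossedVector [IsFiniteMeasure μ] (f : Lp ℂ ∞ μ) :
    crossedFunction Γ μ f (crossedVector Γ μ) =
      deltaTensor 1 (mulLInfty μ f (Lp.const 2 μ (1 : ℂ))) :=
  crossedFunction_deltaTensor f 1 _

end CrossedFunction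

section Koopman

variable {Γ Y : Type*} [Group Γ] [MeasurableSpace Y] [MulAction Γ Y] [MeasurableConstSMul Γ Y]
  {μ : Measure Y} [SMulInvariantMeasure Γ Y μ]

/-- The action `f ↦ f (s⁻¹ ·)` of `s` on `L^∞(Y, μ)`. -/
def koopmanLInfty (μ : Measure Y) [SMulInvariantMeasure Γ Y μ] (s : Γ) (f : Lp ℂ ∞ μ) :
    Lp ℂ ∞ μ :=
  Lp.compMeasurePreserving (fun y : Y => s⁻¹ • y) (measurePreserving_smul s⁻¹ μ) f

theorem coeFn_koopmanLInfty (s : Γ) (f : Lp ℂ ∞ μ) :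
    koopmanLInfty μ s f =ᵐ[μ] fun y => f (s⁻¹ • y) :=
  Lp.coeFn_compMeasurePreserving f (measurePreserving_smul s⁻¹ μ)

theorem coeFn_koopman (s : Γ) (φ : Lp ℂ 2 μ) : koopman μ s φ =ᵐ[μ] fun y => φ (s⁻¹ • y) :=
  Lp.coeFn_compMeasurePreserving φ (measurePreserving_smul s⁻¹ μ)

theorem ae_smul {p : Y → Prop} (s : Γ) (h : ∀ᵐ y ∂μ, p y) : ∀ᵐ y ∂μ, p (s • y) :=
  (measurePreserving_smul s μ).quasiMeasurePreserving.ae h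

theorem koopman_koopman (s t : Γ) (φ : Lp ℂ 2 μ) :
    koopman μ s (koopman μ t φ) = koopman μ (s * t) φ := by
  apply Lp.ext
  filter_upwards [coeFn_koopman s (koopman μ t φ), ae_smul s⁻¹ (coeFn_koopman t φ),
    coeFn_koopman (s * t) φ] with y h1 h2 h3
  rw [h1, h2, h3, mul_inv_rev, mul_smul]

theorem koopman_one (φ : Lp ℂ 2 μ) : koopman μ (1 : Γ) φ = φ := by
  apply Lp.ext
  filter_upwards [coeFn_koopman (1 : Γ) φ] with y h1
  rw [h1, inv_one, one_smul]

theorem norm_koopman (s : Γ) (φ : Lp ℂ 2 μ) : ‖koopman μ s φ‖ = ‖φ‖ :=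
  Lp.norm_compMeasurePreserving φ (measurePreserving_smul s⁻¹ μ)

theorem koopman_const [IsFiniteMeasure μ] (s : Γ) (c : ℂ) :
    koopman μ s (Lp.const 2 μ c) = Lp.const 2 μ c := by
  apply Lp.ext
  filter_upwards [coeFn_koopman s (Lp.const 2 μ c), Lp.coeFn_const 2 μ c,
    ae_smul s⁻¹ (Lp.coeFn_const 2 μ c)] with y h1 h2 h3
  rw [h1, h2, h3]; rfl

theorem inner_koopman_koopman (s : Γ) (φ ψ : Lp ℂ 2 μ) :
    ⟪koopman μ s φ, koopman μ s ψ⟫_ℂ = ⟪φ, ψ⟫_ℂ :=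
  LinearIsometry.inner_map_map (𝕜 := ℂ) (Lp.compMeasurePreservingₗᵢ (E := ℂ) (p := 2) ℂ
    (fun y : Y => s⁻¹ • y) (measurePreserving_smul s⁻¹ μ)) φ ψ

theorem inner_koopman_left (s : Γ) (φ ψ : Lp ℂ 2 μ) :
    ⟪koopman μ s φ, ψ⟫_ℂ = ⟪φ, koopman μ s⁻¹ ψ⟫_ℂ := by
  rw [← inner_koopman_koopman s φ, koopman_koopman, mul_inv_cancel, koopman_one]

theorem star_koopman (s : Γ) : star (koopman μ s) = koopman μ s⁻¹ := by
  rw [ContinuousLinearMap.star_eq_adjoint, eq_comm, ContinuousLinearMap.eq_adjoint_iff]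
  intro φ ψ
  rw [inner_koopman_left, inv_inv]

theorem koopman_conjLTwo (s : Γ) (φ : Lp ℂ 2 μ) :
    koopman μ s (conjLTwo μ φ) = conjLTwo μ (koopman μ s φ) := by
  apply Lp.ext
  filter_upwards [coeFn_koopman s (conjLTwo μ φ), ae_smul s⁻¹ (coeFn_conjLTwo φ),
    coeFn_conjLTwo (koopman μ s φ), coeFn_koopman s φ] with y h1 h2 h3 h4
  rw [h1, h2, h3, h4]

theorem koopman_mulLInfty (s : Γ) (f : Lp ℂ ∞ μ) (φ : Lp ℂ 2 μ) :
    koopman μ s (mulLInfty μ f φ) = mulLInfty μ (koopmanLInfty μ s f) (koopman μ s φ) := by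
  apply Lp.ext
  filter_upwards [coeFn_koopman s (mulLInfty μ f φ), ae_smul s⁻¹ (coeFn_mulLInfty f φ),
    coeFn_mulLInfty (koopmanLInfty μ s f) (koopman μ s φ), coeFn_koopman s φ,
    coeFn_koopmanLInfty s f] with y h1 h2 h3 h4 h5
  rw [h1, h2, h3, h4, h5]

theorem koopmanLInfty_koopmanLInfty (s t : Γ) (f : Lp ℂ ∞ μ) :
    koopmanLInfty μ s (koopmanLInfty μ t f) = koopmanLInfty μ (s * t) f := by
  apply Lp.ext
  filter_upwards [coeFn_koopmanLInfty s (koopmanLInfty μ t f),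
    ae_smul s⁻¹ (coeFn_koopmanLInfty t f), coeFn_koopmanLInfty (s * t) f] with y h1 h2 h3
  rw [h1, h2, h3, mul_inv_rev, mul_smul]

theorem crossedUnitary_apply (s g : Γ) (ξ : EllTwo Γ (Lp ℂ 2 μ)) :
    crossedUnitary μ s ξ g = koopman μ s (ξ (s⁻¹ * g)) := rfl

theorem star_crossedUnitary (s : Γ) : star (crossedUnitary μ s) = crossedUnitary μ s⁻¹ := by
  rw [crossedUnitary, star_tensorShift, star_koopman, crossedUnitary]

theorem crossedUnitary_deltaTensor (s g : Γ) (φ : Lp ℂ 2 μ) :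
    crossedUnitary μ s (deltaTensor g φ) = deltaTensor (s * g) (koopman μ s φ) :=
  tensorShift_deltaTensor _ _ _ _

theorem crossedUnitary_crossedVector [IsFiniteMeasure μ] (s : Γ) :
    crossedUnitary μ s (crossedVector Γ μ) = deltaTensor s (Lp.const 2 μ (1 : ℂ)) := by
  rw [crossedVector, crossedUnitary_deltaTensor, koopman_const, mul_one]

variable (Γ μ)

/-- The modular conjugation `(J ξ)(g) = σ_g (conj (ξ g⁻¹))` of `L^∞(Y, μ) ⋊ Γ`. -/
def crossedConj : EllTwo Γ (Lp ℂ 2 μ) →ₗᵢ⋆[ℂ] EllTwo Γ (Lp ℂ 2 μ) :=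
  have norm_apply (ξ : EllTwo Γ (Lp ℂ 2 μ)) (g : Γ) :
      ‖koopman μ g (conjLTwo μ (ξ g⁻¹))‖ = ‖ξ g⁻¹‖ := by
    rw [norm_koopman, LinearIsometry.norm_map]
  have memℓp (ξ : EllTwo Γ (Lp ℂ 2 μ)) :
      Memℓp (fun g : Γ => koopman μ g (conjLTwo μ (ξ g⁻¹))) 2 := by
    refine memℓp_gen ?_
    simp_rw [norm_apply]
    exact (Equiv.inv Γ).summable_iff.mpr ((lp.memℓp ξ).summable (by norm_num))
  { toFun := fun ξ => ⟨fun g => koopman μ g (conjLTwo μ (ξ g⁻¹)), memℓp ξ⟩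
    map_add' := fun ξ η => by
      ext1; funext g
      change koopman μ g (conjLTwo μ (ξ g⁻¹ + η g⁻¹)) = _
      rw [map_add, map_add]
      rfl
    map_smul' := fun c ξ => by
      ext1; funext g
      change koopman μ g (conjLTwo μ (c • ξ g⁻¹)) = _
      rw [map_smulₛₗ, map_smul]
      rfl
    norm_map' := fun ξ => by
      rw [lp.norm_eq_tsum_rpow (by norm_num), lp.norm_eq_tsum_rpow (by norm_num)]
      congr 1
      rw [← (Equiv.inv Γ).tsum_eq]
      refine tsum_congr fun g => ?_
      change ‖koopman μ g⁻¹ (conjLTwo μ (ξ g⁻¹⁻¹))‖ ^ _ = _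
      rw [norm_apply, inv_inv] }

variable {Γ μ}

theorem crossedConj_apply (ξ : EllTwo Γ (Lp ℂ 2 μ)) (g : Γ) :
    crossedConj Γ μ ξ g = koopman μ g (conjLTwo μ (ξ g⁻¹)) := rfl

theorem crossedConj_crossedConj (ξ : EllTwo Γ (Lp ℂ 2 μ)) :
    crossedConj Γ μ (crossedConj Γ μ ξ) = ξ := by
  ext1; funext g
  rw [crossedConj_apply, crossedConj_apply, ← koopman_conjLTwo, koopman_koopman,
    conjLTwo_conjLTwo, mul_inv_cancel, koopman_one, inv_inv]

theorem crossedConj_deltaTensor (g : Γ) (φ : Lp ℂ 2 μ) :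
    crossedConj Γ μ (deltaTensor g φ) = deltaTensor g⁻¹ (koopman μ g⁻¹ (conjLTwo μ φ)) := by
  ext1; funext k
  rw [crossedConj_apply]
  by_cases h : k = g⁻¹
  · rw [h, inv_inv, deltaTensor_self, deltaTensor_self]
  · rw [deltaTensor_of_ne h, deltaTensor_of_ne (mt inv_eq_iff_eq_inv.mp h), map_zero, map_zero]

theorem crossedConj_crossedVector [IsFiniteMeasure μ] :
    crossedConj Γ μ (crossedVector Γ μ) = crossedVector Γ μ := by
  rw [crossedVector, crossedConj_deltaTensor, conjLTwo_const_one, koopman_const, inv_one]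

theorem antilinearConj_crossedConj_crossedUnitary_apply (s : Γ) (ξ : EllTwo Γ (Lp ℂ 2 μ)) (g : Γ) :
    antilinearConj (crossedConj Γ μ) (crossedUnitary μ s) ξ g = ξ (g * s) := by
  rw [antilinearConj_apply, crossedConj_apply, crossedUnitary_apply, crossedConj_apply,
    koopman_koopman, ← koopman_conjLTwo, conjLTwo_conjLTwo, koopman_koopman]
  simp [koopman_one]

theorem antilinearConj_crossedConj_mul_apply (f : Lp ℂ ∞ μ) (s : Γ) (ξ : EllTwo Γ (Lp ℂ 2 μ))
    (g : Γ) :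
    antilinearConj (crossedConj Γ μ) (crossedFunction Γ μ f * crossedUnitary μ s) ξ g =
      mulLInfty μ (koopmanLInfty μ g (star f)) (ξ (g * s)) := by
  rw [← antilinearConj_crossedConj_crossedUnitary_apply, antilinearConj_apply, antilinearConj_apply,
    crossedConj_apply, crossedConj_apply, mul_apply_eq_comp, crossedFunction_apply,
    conjLTwo_mulLInfty, koopman_mulLInfty]

theorem crossedUnitary_mem_groupVN (s : Γ) : crossedUnitary μ s ∈ groupVN Γ μ :=
  subset_vonNeumannClosure _ ⟨s, rfl⟩

theorem crossedUnitary_mem_crossedProduct (s : Γ) : crossedUnitary μ s ∈ crossedProduct Γ μ :=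
  subset_vonNeumannClosure _ (Or.inr ⟨s, rfl⟩)

theorem crossedFunction_mem_crossedProduct (f : Lp ℂ ∞ μ) :
    crossedFunction Γ μ f ∈ crossedProduct Γ μ :=
  subset_vonNeumannClosure _ (Or.inl ⟨f, rfl⟩)

theorem groupVN_le_crossedProduct : groupVN Γ μ ≤ crossedProduct Γ μ :=
  (vonNeumannClosure_le_iff _ _).mpr <|
    Set.range_subset_iff.mpr fun s => crossedUnitary_mem_crossedProduct s

theorem mem_commutant_crossedProduct {r : EllTwo Γ (Lp ℂ 2 μ) →L[ℂ] EllTwo Γ (Lp ℂ 2 μ)}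
    (hf : ∀ f, crossedFunction Γ μ f * r = r * crossedFunction Γ μ f)
    (hu : ∀ s : Γ, crossedUnitary μ s * r = r * crossedUnitary μ s) :
    r ∈ (crossedProduct Γ μ).commutant := by
  refine mem_commutant_vonNeumannClosure ?_ ?_
  · rintro _ (⟨f, rfl⟩ | ⟨s, rfl⟩)
    · exact Or.inl ⟨star f, (star_crossedFunction f).symm⟩
    · exact Or.inr ⟨s⁻¹, (star_crossedUnitary s).symm⟩
  · rintro _ (⟨f, rfl⟩ | ⟨s, rfl⟩)
    exacts [hf f, hu s]

theorem antilinearConj_crossedConj_mul_mem_commutant (f : Lp ℂ ∞ μ) (s : Γ) :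
    antilinearConj (crossedConj Γ μ) (crossedFunction Γ μ f * crossedUnitary μ s) ∈
      (crossedProduct Γ μ).commutant := by
  refine mem_commutant_crossedProduct (fun f' => ?_) (fun t => ?_) <;> ext ξ : 1 <;> ext1 <;>
    funext g
  · simp only [mul_apply_eq_comp, crossedFunction_apply, antilinearConj_crossedConj_mul_apply,
      mulLInfty_comm f']
  · simp only [mul_apply_eq_comp, crossedUnitary_apply, antilinearConj_crossedConj_mul_apply,
      koopman_mulLInfty, koopmanLInfty_koopmanLInfty, mul_inv_cancel_left, mul_assoc]

theorem isModularConjugation_crossedConj [IsFiniteMeasure μ] :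
    IsModularConjugation (crossedProduct Γ μ) (crossedConj Γ μ) (crossedVector Γ μ) := by
  refine .of_total crossedConj_crossedConj crossedConj_crossedVector
    (Set.range fun p : Lp ℂ ∞ μ × Γ => crossedFunction Γ μ p.1 * crossedUnitary μ p.2) ?_ ?_ ?_
  · rintro _ ⟨⟨f, s⟩, rfl⟩
    rw [star_mul, star_crossedUnitary, star_crossedFunction, mul_apply_eq_comp,
      mul_apply_eq_comp, crossedUnitary_crossedVector, crossedFunction_deltaTensor,
      crossedConj_deltaTensor, crossedFunction_crossedVector, crossedUnitary_deltaTensor,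
      conjLTwo_mulLInfty, conjLTwo_const_one, mul_one]
  · rintro _ ⟨⟨f, s⟩, rfl⟩
    exact antilinearConj_crossedConj_mul_mem_commutant f s
  · intro ζ h
    ext1; funext s
    refine eq_zero_of_forall_inner_mulLInfty fun f => ?_
    simpa only [mul_apply_eq_comp, crossedUnitary_crossedVector, crossedFunction_deltaTensor,
      inner_deltaTensor_left] using h _ ⟨(f, s), rfl⟩

end Koopman

/-! ### Characters of a compact abelian group -/

section PontryaginDual

variable {A : Type*} [CommGroup A] [TopologicalSpace A]

/-- Evaluation at `a ∈ A`, as a complex-valued character of the Pontryagin dual of `A`. -/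
def dualEval (a : A) : C(PontryaginDual A, ℂ) where
  toFun χ := (χ a : ℂ)
  continuous_toFun := continuous_subtype_val.comp
    ((ContinuousEvalConst.continuous_eval_const (F := C(A, Circle)) a).comp
      (ContinuousMonoidHom.isInducing_toContinuousMap A Circle).continuous)

theorem dualEval_apply (a : A) (χ : PontryaginDual A) : dualEval a χ = χ a := rfl

theorem dualEval_one : dualEval (1 : A) = 1 := by
  ext χ
  rw [dualEval_apply, map_one, Circle.coe_one, ContinuousMap.one_apply]

theorem dualEval_mul (a b : A) : dualEval (a * b) = dualEval a * dualEval b := by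
  ext χ
  rw [dualEval_apply, map_mul, Circle.coe_mul, ContinuousMap.mul_apply, dualEval_apply,
    dualEval_apply]

theorem dualEval_inv_apply (a : A) (χ : PontryaginDual A) :
    dualEval a⁻¹ χ = conj (dualEval a χ) := by
  rw [dualEval_apply, dualEval_apply, map_inv, Circle.coe_inv_eq_conj]

theorem dualEval_apply_inv (a : A) (χ : PontryaginDual A) : dualEval a χ⁻¹ = dualEval a⁻¹ χ := by
  rw [dualEval_inv_apply]
  exact Circle.coe_inv_eq_conj _

theorem star_dualEval (a : A) : star (dualEval a) = dualEval a⁻¹ :=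
  ContinuousMap.ext fun χ => (dualEval_inv_apply a χ).symm

theorem norm_dualEval_apply (a : A) (χ : PontryaginDual A) : ‖dualEval a χ‖ = 1 := by
  rw [dualEval_apply, Circle.norm_coe]

theorem map_ratCast_addCircle_injective :
    Function.Injective (QuotientAddGroup.map (AddSubgroup.zmultiples (1 : ℚ))
      (AddSubgroup.zmultiples (1 : ℝ)) (algebraMap ℚ ℝ).toAddMonoidHom (by simp)) := by
  rw [injective_iff_map_eq_zero]
  rintro ⟨q⟩ hq
  obtain ⟨n, hn⟩ := AddSubgroup.mem_zmultiples_iff.mp ((QuotientAddGroup.eq_zero_iff _).mp hq)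
  refine (QuotientAddGroup.eq_zero_iff _).mpr
    (AddSubgroup.mem_zmultiples_iff.mpr ⟨n, Rat.cast_injective (α := ℝ) ?_⟩)
  simpa using hn

/-- The circle contains the injective cogenerator `ℚ / ℤ`. -/
theorem exists_pontryaginDual_apply_ne_one [DiscreteTopology A] {a : A} (ha : a ≠ 1) :
    ∃ χ : PontryaginDual A, χ a ≠ 1 := by
  obtain ⟨c, hc⟩ := CharacterModule.exists_character_apply_ne_zero_of_ne_zero
    (A := Additive A) (a := Additive.ofMul a) ha
  let toReal := QuotientAddGroup.map (AddSubgroup.zmultiples (1 : ℚ))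
    (AddSubgroup.zmultiples (1 : ℝ)) (algebraMap ℚ ℝ).toAddMonoidHom (by simp)
  let χ : A →ₜ* Circle :=
    { toFun b := AddCircle.toCircle (toReal (c (Additive.ofMul b)))
      map_one' := by simp
      map_mul' b b' := by simp [AddCircle.toCircle_add]
      continuous_toFun := continuous_of_discreteTopology }
  refine ⟨χ, fun h => hc (map_ratCast_addCircle_injective ?_)⟩
  refine AddCircle.injective_toCircle one_ne_zero ?_
  rw [map_zero, AddCircle.toCircle_zero]
  exact h

/-- The star subalgebra of `C(PontryaginDual A, ℂ)` spanned by the characters `dualEval a`. -/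
def dualEvalSubalgebra (A : Type*) [CommGroup A] [TopologicalSpace A] :
    StarSubalgebra ℂ C(PontryaginDual A, ℂ) where
  toSubalgebra := Algebra.adjoin ℂ (Set.range dualEval)
  star_mem' := by
    change Algebra.adjoin ℂ (Set.range dualEval) ≤ star (Algebra.adjoin ℂ (Set.range dualEval))
    refine Algebra.adjoin_le ?_
    rintro - ⟨a, rfl⟩
    exact Algebra.subset_adjoin ⟨a⁻¹, (star_dualEval a).symm⟩

theorem toSubmodule_dualEvalSubalgebra :
    Subalgebra.toSubmodule (dualEvalSubalgebra A).toSubalgebra =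
      Submodule.span ℂ (Set.range dualEval) := by
  refine Algebra.adjoin_eq_span_of_subset _ (Set.Subset.trans ?_ Submodule.subset_span)
  intro x hx
  refine Submonoid.closure_induction (fun _ => id) ⟨1, dualEval_one⟩ ?_ hx
  rintro - - - - ⟨a, rfl⟩ ⟨b, rfl⟩
  exact ⟨a * b, dualEval_mul a b⟩

theorem separatesPoints_dualEvalSubalgebra : (dualEvalSubalgebra A).SeparatesPoints := by
  intro χ ψ hne
  by_contra! hcon
  refine hne (PontryaginDual.ext fun a => Circle.coe_injective ?_)
  exact hcon (dualEval a) ⟨dualEval a, Algebra.subset_adjoin ⟨a, rfl⟩, rfl⟩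

variable [DiscreteTopology A]

theorem span_dualEval_closure_eq_top :
    (Submodule.span ℂ (Set.range (dualEval (A := A)))).topologicalClosure = ⊤ := by
  rw [← toSubmodule_dualEvalSubalgebra]
  exact congrArg (Subalgebra.toSubmodule <| StarSubalgebra.toSubalgebra ·)
    (ContinuousMap.starSubalgebra_topologicalClosure_eq_top_of_separatesPoints _
      separatesPoints_dualEvalSubalgebra)

variable [MeasurableSpace (PontryaginDual A)] [BorelSpace (PontryaginDual A)]
  (ν : Measure (PontryaginDual A))

theorem integral_dualEval [ν.IsMulLeftInvariant] {a : A} (ha : a ≠ 1) :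
    ∫ χ, dualEval a χ ∂ν = 0 := by
  obtain ⟨χ₀, hχ₀⟩ := exists_pontryaginDual_apply_ne_one ha
  have translate : ∫ χ, dualEval a χ ∂ν = χ₀ a * ∫ χ, dualEval a χ ∂ν := by
    rw [← integral_const_mul, ← integral_mul_left_eq_self _ χ₀]
    exact integral_congr_ae (.of_forall fun χ => Circle.coe_mul (χ₀ a) (χ a))
  by_contra h
  exact hχ₀ (Circle.coe_injective (by simpa using (mul_eq_right₀ h).mp translate.symm))

variable [IsProbabilityMeasure ν]

/-- The character `dualEval a` as an element of `L²`. -/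
def dualEvalLp (a : A) : Lp ℂ 2 ν := ContinuousMap.toLp 2 ν ℂ (dualEval a)

theorem coeFn_dualEvalLp (a : A) : dualEvalLp ν a =ᵐ[ν] dualEval a :=
  ContinuousMap.coeFn_toLp ν (dualEval a)

theorem span_dualEvalLp_closure_eq_top [ν.Regular] :
    (Submodule.span ℂ (Set.range (dualEvalLp (A := A) ν))).topologicalClosure = ⊤ := by
  convert! (ContinuousMap.toLp_denseRange ℂ ν ℂ
    (by norm_num : (2 : ℝ≥0∞) ≠ ∞)).topologicalClosure_map_submodule
      (span_dualEval_closure_eq_top (A := A))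
  rw [Submodule.map_span, ← Set.range_comp]
  rfl

variable [ν.IsMulLeftInvariant]

theorem orthonormal_dualEvalLp : Orthonormal ℂ (dualEvalLp (A := A) ν) := by
  classical
  rw [orthonormal_iff_ite]
  intro a b
  have inner_eq : ⟪dualEvalLp ν a, dualEvalLp ν b⟫_ℂ = ∫ χ, dualEval (b * a⁻¹) χ ∂ν := by
    rw [L2.inner_def]
    refine integral_congr_ae ?_
    filter_upwards [coeFn_dualEvalLp ν a, coeFn_dualEvalLp ν b] with χ h1 h2
    rw [h1, h2, dualEval_mul, ContinuousMap.mul_apply, dualEval_inv_apply, RCLike.inner_apply]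
  rw [inner_eq]
  split_ifs with h
  · simp [h, dualEval_one]
  · exact integral_dualEval ν (mul_inv_eq_one.not.mpr (Ne.symm h))

/-- The characters of a compact abelian group as a Hilbert basis of its `L²` space. -/
def dualEvalBasis [ν.Regular] : HilbertBasis A ℂ (Lp ℂ 2 ν) :=
  HilbertBasis.mk (orthonormal_dualEvalLp ν) (span_dualEvalLp_closure_eq_top ν).ge

theorem dualEvalBasis_apply [ν.Regular] (a : A) : dualEvalBasis ν a = dualEvalLp ν a :=
  congrFun (HilbertBasis.coe_mk _ _) a

end PontryaginDual

/-! ### Fourier analysis on the quotient of the dual of `ℚ²` -/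

section Fourier

instance : haarDual.IsHaarMeasure := by unfold haarDual; infer_instance

instance : haarDual.Regular := by unfold haarDual; infer_instance

instance : IsProbabilityMeasure haarDual := ⟨by
  have := Measure.haarMeasure_self (G := DualRatSq) (K₀ := ⊤)
  simpa [haarDual] using this⟩

theorem DualQuot.measurePreserving_mk :
    MeasurePreserving DualQuot.mk haarDual DualQuot.measure :=
  ⟨DualQuot.measurable_mk, rfl⟩

instance : IsProbabilityMeasure DualQuot.measure :=
  Measure.isProbabilityMeasure_map DualQuot.measurable_mk.aemeasurable

theorem DualQuot.mk_inv (χ : DualRatSq) : DualQuot.mk χ⁻¹ = DualQuot.mk χ :=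
  Quotient.sound (Or.inr fun v => (inv_inv (χ (RatSq.of v))).symm.trans
    (congrArg (·⁻¹) (map_inv χ (RatSq.of v)).symm))

/-- The function `χ ↦ χ(v) + χ(-v)` on the quotient. -/
def cosFun (v : Fin 2 → ℚ) : DualQuot → ℂ :=
  Quotient.lift (fun χ : DualRatSq => dualEval (RatSq.of v) χ + dualEval (RatSq.of v)⁻¹ χ) (by
    rintro χ ψ (h | h)
    · rw [h]
    · have dualEval_eq (w) : dualEval (RatSq.of w) ψ = dualEval (RatSq.of w)⁻¹ χ :=
        congrArg (fun z : Circle => (z : ℂ)) (h w)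
      rw [dualEval_eq, dualEval_inv_apply _ ψ, dualEval_eq, ← dualEval_inv_apply, inv_inv,
        add_comm])

theorem cosFun_mk (v : Fin 2 → ℚ) (χ : DualRatSq) :
    cosFun v (DualQuot.mk χ) = dualEval (RatSq.of v) χ + dualEval (RatSq.of v)⁻¹ χ := rfl

theorem cosFun_zero (y : DualQuot) : cosFun 0 y = 2 := by
  obtain ⟨χ⟩ := y
  change dualEval (1 : RatSq) χ + dualEval (1 : RatSq)⁻¹ χ = 2
  rw [inv_one, dualEval_one, ContinuousMap.one_apply, one_add_one_eq_two]

theorem cosFun_neg (v : Fin 2 → ℚ) (y : DualQuot) : cosFun (-v) y = cosFun v y := by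
  obtain ⟨χ⟩ := y
  change dualEval (RatSq.of v)⁻¹ χ + dualEval (RatSq.of v)⁻¹⁻¹ χ = cosFun v (DualQuot.mk χ)
  rw [cosFun_mk, inv_inv, add_comm]

theorem cosFun_mul (v z : Fin 2 → ℚ) (y : DualQuot) :
    cosFun v y * cosFun z y = cosFun (z + v) y + cosFun (z - v) y := by
  obtain ⟨χ⟩ := y
  have of_add : RatSq.of (z + v) = RatSq.of z * RatSq.of v := rfl
  have of_sub : RatSq.of (z - v) = RatSq.of z * (RatSq.of v)⁻¹ :=
    congrArg RatSq.of (sub_eq_add_neg z v)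
  change cosFun v (DualQuot.mk χ) * cosFun z (DualQuot.mk χ) =
    cosFun (z + v) (DualQuot.mk χ) + cosFun (z - v) (DualQuot.mk χ)
  simp only [cosFun_mk, of_add, of_sub, mul_inv, inv_inv, dualEval_mul, ContinuousMap.mul_apply]
  ring

theorem conj_cosFun (v : Fin 2 → ℚ) (y : DualQuot) : conj (cosFun v y) = cosFun v y := by
  obtain ⟨χ⟩ := y
  change conj (cosFun v (DualQuot.mk χ)) = cosFun v (DualQuot.mk χ)
  rw [cosFun_mk, map_add, ← dualEval_inv_apply, ← dualEval_inv_apply, inv_inv, add_comm]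

theorem cosFun_smul (s : SL(2, ℚ)) (v : Fin 2 → ℚ) (y : DualQuot) :
    cosFun v ((s : PSL(2, ℚ))⁻¹ • y) = cosFun (s.1.mulVec v) y := by
  obtain ⟨χ⟩ := y
  have dualEval_smul : dualEval (RatSq.of v) (s⁻¹ • χ) = dualEval (RatSq.of (s.1.mulVec v)) χ := by
    rw [dualEval_apply, smul_dualRatSq_apply, inv_inv, dualEval_apply]
  change cosFun v (DualQuot.mk (s⁻¹ • χ)) = cosFun (s.1.mulVec v) (DualQuot.mk χ)
  rw [cosFun_mk, cosFun_mk, dualEval_inv_apply, dualEval_inv_apply, dualEval_smul]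

theorem norm_cosFun_le (v : Fin 2 → ℚ) (y : DualQuot) : ‖cosFun v y‖ ≤ 2 := by
  obtain ⟨χ⟩ := y
  refine (norm_add_le _ _).trans ?_
  rw [norm_dualEval_apply, norm_dualEval_apply, one_add_one_eq_two]

theorem measurable_cosFun (v : Fin 2 → ℚ) : Measurable (cosFun v) :=
  fun _ hs => ((dualEval (RatSq.of v)).continuous.add
    (dualEval (RatSq.of v)⁻¹).continuous).measurable hs

/-- The function `χ ↦ χ(v) + χ(-v)` in `L^∞`. -/
def cosLInfty (v : Fin 2 → ℚ) : Lp ℂ ∞ DualQuot.measure :=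
  (memLp_top_of_bound (measurable_cosFun v).aestronglyMeasurable 2
    (Filter.Eventually.of_forall (norm_cosFun_le v))).toLp (cosFun v)

theorem coeFn_cosLInfty (v : Fin 2 → ℚ) : cosLInfty v =ᵐ[DualQuot.measure] cosFun v :=
  MemLp.coeFn_toLp _

/-- The function `χ ↦ χ(v) + χ(-v)` in `L²`. -/
def cosLTwo (v : Fin 2 → ℚ) : Lp ℂ 2 DualQuot.measure :=
  mulLInfty DualQuot.measure (cosLInfty v) (Lp.const 2 DualQuot.measure (1 : ℂ))

theorem coeFn_cosLTwo (v : Fin 2 → ℚ) : cosLTwo v =ᵐ[DualQuot.measure] cosFun v := by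
  filter_upwards [coeFn_mulLInfty (cosLInfty v) (Lp.const 2 DualQuot.measure (1 : ℂ)),
    coeFn_cosLInfty v, Lp.coeFn_const 2 DualQuot.measure (1 : ℂ)] with y h1 h2 h3
  rw [cosLTwo, h1, h2, h3, Function.const_apply, mul_one]

theorem cosLTwo_zero : cosLTwo 0 = (2 : ℂ) • Lp.const 2 DualQuot.measure (1 : ℂ) := by
  apply Lp.ext
  filter_upwards [coeFn_cosLTwo 0, Lp.coeFn_const 2 DualQuot.measure (1 : ℂ),
    Lp.coeFn_smul (2 : ℂ) (Lp.const 2 DualQuot.measure (1 : ℂ))] with y h1 h2 h3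
  rw [h1, h3, Pi.smul_apply, h2, cosFun_zero]
  simp

theorem cosLTwo_neg (v : Fin 2 → ℚ) : cosLTwo (-v) = cosLTwo v := by
  apply Lp.ext
  filter_upwards [coeFn_cosLTwo (-v), coeFn_cosLTwo v] with y h1 h2
  rw [h1, h2, cosFun_neg]

theorem mulLInfty_cosLTwo (v z : Fin 2 → ℚ) :
    mulLInfty DualQuot.measure (cosLInfty v) (cosLTwo z) = cosLTwo (z + v) + cosLTwo (z - v) := by
  apply Lp.ext
  filter_upwards [coeFn_mulLInfty (cosLInfty v) (cosLTwo z), coeFn_cosLInfty v, coeFn_cosLTwo z,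
    coeFn_cosLTwo (z + v), coeFn_cosLTwo (z - v),
    Lp.coeFn_add (cosLTwo (z + v)) (cosLTwo (z - v))] with y h1 h2 h3 h4 h5 h6
  rw [h1, h2, h3, h6, Pi.add_apply, h4, h5, cosFun_mul]

theorem star_cosLInfty (v : Fin 2 → ℚ) : star (cosLInfty v) = cosLInfty v := by
  apply Lp.ext
  filter_upwards [Lp.coeFn_star (cosLInfty v), coeFn_cosLInfty v] with y h1 h2
  rw [h1, Pi.star_apply, h2]
  exact conj_cosFun v y

theorem conjLTwo_cosLTwo (v : Fin 2 → ℚ) :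
    conjLTwo DualQuot.measure (cosLTwo v) = cosLTwo v := by
  apply Lp.ext
  filter_upwards [coeFn_conjLTwo (cosLTwo v), coeFn_cosLTwo v] with y h1 h2
  rw [h1, h2, conj_cosFun]

theorem koopman_cosLTwo (s : SL(2, ℚ)) (v : Fin 2 → ℚ) :
    koopman DualQuot.measure (s : PSL(2, ℚ)) (cosLTwo v) = cosLTwo (s.1.mulVec v) := by
  apply Lp.ext
  filter_upwards [coeFn_koopman (s : PSL(2, ℚ)) (cosLTwo v),
    ae_smul (s : PSL(2, ℚ))⁻¹ (coeFn_cosLTwo v), coeFn_cosLTwo (s.1.mulVec v)] with y h1 h2 h3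
  rw [h1, h2, h3, cosFun_smul]

/-- Pullback of functions from the quotient to the dual of `ℚ²`, on `L²`. -/
def liftLTwo : Lp ℂ 2 DualQuot.measure →ₗᵢ[ℂ] Lp ℂ 2 haarDual :=
  Lp.compMeasurePreservingₗᵢ ℂ DualQuot.mk DualQuot.measurePreserving_mk

theorem coeFn_liftLTwo (φ : Lp ℂ 2 DualQuot.measure) :
    liftLTwo φ =ᵐ[haarDual] fun χ => φ (DualQuot.mk χ) :=
  Lp.coeFn_compMeasurePreserving φ DualQuot.measurePreserving_mk

theorem liftLTwo_cosLTwo (v : Fin 2 → ℚ) :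
    liftLTwo (cosLTwo v) =
      dualEvalLp haarDual (RatSq.of v) + dualEvalLp haarDual (RatSq.of v)⁻¹ := by
  apply Lp.ext
  filter_upwards [coeFn_liftLTwo (cosLTwo v),
    DualQuot.measurePreserving_mk.quasiMeasurePreserving.ae (coeFn_cosLTwo v),
    coeFn_dualEvalLp haarDual (RatSq.of v), coeFn_dualEvalLp haarDual (RatSq.of v)⁻¹,
    Lp.coeFn_add (dualEvalLp haarDual (RatSq.of v)) (dualEvalLp haarDual (RatSq.of v)⁻¹)]
    with χ h1 h2 h3 h4 h5
  rw [h1, h2, h5, Pi.add_apply, h3, h4, cosFun_mk]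

theorem inner_dualEvalLp_inv (a : RatSq) (φ : Lp ℂ 2 DualQuot.measure) :
    ⟪dualEvalLp haarDual a⁻¹, liftLTwo φ⟫_ℂ = ⟪dualEvalLp haarDual a, liftLTwo φ⟫_ℂ := by
  have inner_eq (b : RatSq) : ⟪dualEvalLp haarDual b, liftLTwo φ⟫_ℂ =
      ∫ χ, φ (DualQuot.mk χ) * conj (dualEval b χ) ∂haarDual := by
    rw [L2.inner_def]
    refine integral_congr_ae ?_
    filter_upwards [coeFn_dualEvalLp haarDual b, coeFn_liftLTwo φ] with χ h1 h2
    rw [h1, h2, RCLike.inner_apply]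
  rw [inner_eq, inner_eq, ← integral_inv_eq_self]
  simp_rw [DualQuot.mk_inv, dualEval_apply_inv, inv_inv]

theorem inner_cosLTwo (v : Fin 2 → ℚ) (φ : Lp ℂ 2 DualQuot.measure) :
    ⟪cosLTwo v, φ⟫_ℂ = 2 * ⟪dualEvalLp haarDual (RatSq.of v), liftLTwo φ⟫_ℂ := by
  rw [← LinearIsometry.inner_map_map liftLTwo, liftLTwo_cosLTwo, inner_add_left,
    inner_dualEvalLp_inv, two_mul]

theorem inner_cosLTwo_cosLTwo (v w : Fin 2 → ℚ) :
    ⟪cosLTwo v, cosLTwo w⟫_ℂ = 2 * ((if v = w then 1 else 0) + if v = -w then 1 else 0) := by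
  classical
  have inner_eq (w : Fin 2 → ℚ) : ⟪dualEvalLp haarDual (RatSq.of v), dualEvalLp haarDual
      (RatSq.of w)⟫_ℂ = if v = w then 1 else 0 :=
    (orthonormal_iff_ite.mp (orthonormal_dualEvalLp haarDual) _ _).trans (if_congr Iff.rfl rfl rfl)
  rw [inner_cosLTwo, liftLTwo_cosLTwo, inner_add_right, inner_eq]
  exact congrArg (fun c => 2 * ((if v = w then 1 else 0) + c)) (inner_eq (-w))

/-- Parseval's identity; the factor `4` appears since each pair `±z` is counted twice and
`‖cosLTwo z‖² = 2` for `z ≠ 0`. -/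
theorem hasSum_inner_cosLTwo (φ ψ : Lp ℂ 2 DualQuot.measure) :
    HasSum (fun z => ⟪φ, cosLTwo z⟫_ℂ * ⟪cosLTwo z, ψ⟫_ℂ) (4 * ⟪φ, ψ⟫_ℂ) := by
  have h := ((dualEvalBasis haarDual).hasSum_inner_mul_inner (liftLTwo φ) (liftLTwo ψ)).mul_left 4
  rw [LinearIsometry.inner_map_map] at h
  refine (Multiplicative.ofAdd.hasSum_iff.mpr h).congr_fun fun z => ?_
  change _ = 4 * (⟪liftLTwo φ, dualEvalBasis haarDual (RatSq.of z)⟫_ℂ *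
    ⟪dualEvalBasis haarDual (RatSq.of z), liftLTwo ψ⟫_ℂ)
  rw [← inner_conj_symm φ, inner_cosLTwo, inner_cosLTwo, dualEvalBasis_apply, map_mul,
    inner_conj_symm, map_ofNat]
  ring

theorem ext_inner_cosLTwo {φ ψ : Lp ℂ 2 DualQuot.measure}
    (h : ∀ z, ⟪cosLTwo z, φ⟫_ℂ = ⟪cosLTwo z, ψ⟫_ℂ) : φ = ψ := by
  refine ext_inner_left ℂ fun θ => mul_left_cancel₀ (by norm_num : (4 : ℂ) ≠ 0) ?_
  refine (hasSum_inner_cosLTwo θ φ).unique ?_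
  simpa only [h] using hasSum_inner_cosLTwo θ ψ

theorem dense_span_cosLTwo :
    Dense (Submodule.span ℂ (Set.range cosLTwo) : Set (Lp ℂ 2 DualQuot.measure)) := by
  rw [Submodule.dense_iff_topologicalClosure_eq_top, Submodule.topologicalClosure_eq_top_iff,
    Submodule.eq_bot_iff]
  refine fun φ hφ => ext_inner_cosLTwo fun z => ?_
  rw [inner_zero_right]
  exact hφ _ (Submodule.subset_span ⟨z, rfl⟩)

end Fourier

/-! ### Intermediate subalgebras of a crossed product -/

section OrbitProj

theorem exists_lt_eq_of_summable {ι : Type*} {f : ι → ℝ} (hf : Summable f) {c : ℝ} (hc : c ≠ 0)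
    (u : ℕ → ι) (hu : ∀ n, f (u n) = c) : ∃ m n, m < n ∧ u m = u n := by
  by_contra! h
  have hu_inj : Function.Injective u := .of_lt_imp_ne fun m n => h m n
  have tendsto_zero := (hf.comp_injective hu_inj).tendsto_atTop_zero
  simp only [Function.comp_def, hu] at tendsto_zero
  exact hc (tendsto_nhds_unique tendsto_const_nhds tendsto_zero)

theorem summable_norm_sq_ellTwo {Γ E : Type*} [NormedAddCommGroup E] (ξ : EllTwo Γ E) :
    Summable fun g => ‖ξ g‖ ^ 2 := by
  simpa using (lp.memℓp ξ).summable (by norm_num)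

theorem inner_const_one_self {Y : Type*} [MeasurableSpace Y] {μ : Measure Y}
    [IsProbabilityMeasure μ] :
    ⟪Lp.const 2 μ (1 : ℂ), Lp.const 2 μ (1 : ℂ)⟫_ℂ = 1 := by
  rw [inner_self_eq_norm_sq_to_K, Lp.norm_const _ _ _ two_ne_zero]
  simp

variable {Γ Y : Type*} [Group Γ] [MeasurableSpace Y] {μ : Measure Y} [IsFiniteMeasure μ]

/-- The projection of `δ₁ ⊗ φ` onto the closed orbit of the tracial vector under `P`. For `φ = f 1`
with `f ∈ L^∞(Y, μ)`, this is the vector of the conditional expectation of `f ⊗ 1` onto `P`. -/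
def orbitProj (P : VonNeumannAlgebra (EllTwo Γ (Lp ℂ 2 μ))) :
    Lp ℂ 2 μ →L[ℂ] EllTwo Γ (Lp ℂ 2 μ) :=
  (orbitClosure P (crossedVector Γ μ)).starProjection ∘L deltaTensor 1

variable {P : VonNeumannAlgebra (EllTwo Γ (Lp ℂ 2 μ))}

theorem orbitProj_apply (φ : Lp ℂ 2 μ) :
    orbitProj P φ = (orbitClosure P (crossedVector Γ μ)).starProjection (deltaTensor 1 φ) := rfl

theorem orbitProj_mem (φ : Lp ℂ 2 μ) : orbitProj P φ ∈ orbitClosure P (crossedVector Γ μ) :=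
  Submodule.starProjection_apply_mem _ _

theorem orbitProj_const_one : orbitProj P (Lp.const 2 μ (1 : ℂ)) = crossedVector Γ μ :=
  Submodule.starProjection_eq_self_iff.mpr (orbitClosure.apply_mem (one_mem P))

variable [MulAction Γ Y] [MeasurableConstSMul Γ Y] [SMulInvariantMeasure Γ Y μ]

theorem deltaTensor_const_mem (hN : groupVN Γ μ ≤ P) (g : Γ) :
    deltaTensor g (Lp.const 2 μ (1 : ℂ)) ∈ orbitClosure P (crossedVector Γ μ) := by
  rw [← crossedUnitary_crossedVector]
  exact orbitClosure.apply_mem (hN (crossedUnitary_mem_groupVN g))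

theorem starProjection_deltaTensor (hN : groupVN Γ μ ≤ P) (hM : P ≤ crossedProduct Γ μ)
    (φ : Lp ℂ 2 μ) (g k : Γ) :
    (orbitClosure P (crossedVector Γ μ)).starProjection (deltaTensor g φ) k =
      orbitProj P φ (k * g⁻¹) := by
  have deltaTensor_eq : deltaTensor g φ =
      antilinearConj (crossedConj Γ μ) (crossedUnitary μ g⁻¹) (deltaTensor 1 φ) := by
    ext1; funext l
    rw [antilinearConj_crossedConj_crossedUnitary_apply]
    by_cases hl : l = g
    · rw [hl, mul_inv_cancel, deltaTensor_self, deltaTensor_self]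
    · rw [deltaTensor_of_ne hl, deltaTensor_of_ne (mt mul_inv_eq_one.mp hl)]
  rw [deltaTensor_eq, isModularConjugation_crossedConj.starProjection_antilinearConj hM
    (hN (crossedUnitary_mem_groupVN g⁻¹)), antilinearConj_crossedConj_crossedUnitary_apply,
    orbitProj_apply]

theorem orbitProj_koopman (hN : groupVN Γ μ ≤ P) (hM : P ≤ crossedProduct Γ μ) (φ : Lp ℂ 2 μ)
    (s g : Γ) : orbitProj P (koopman μ s φ) g = koopman μ s (orbitProj P φ (s⁻¹ * g * s)) := by
  have deltaTensor_eq : deltaTensor 1 (koopman μ s φ) =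
      crossedUnitary μ s (deltaTensor s⁻¹ φ) := by
    rw [crossedUnitary_deltaTensor, mul_inv_cancel]
  rw [orbitProj_apply, deltaTensor_eq,
    orbitClosure.starProjection_map (hN (crossedUnitary_mem_groupVN s)),
    crossedUnitary_apply, starProjection_deltaTensor hN hM, inv_inv]

theorem crossedConj_orbitProj (hM : P ≤ crossedProduct Γ μ) (φ : Lp ℂ 2 μ) :
    crossedConj Γ μ (orbitProj P φ) = orbitProj P (conjLTwo μ φ) := by
  rw [orbitProj_apply, ← isModularConjugation_crossedConj.starProjection_map hM,
    crossedConj_deltaTensor, inv_one, koopman_one, orbitProj_apply]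

theorem inner_const_orbitProj (hN : groupVN Γ μ ≤ P) {φ : Lp ℂ 2 μ}
    (hφ : ⟪Lp.const 2 μ (1 : ℂ), φ⟫_ℂ = 0) (g : Γ) :
    ⟪Lp.const 2 μ (1 : ℂ), orbitProj P φ g⟫_ℂ = 0 := by
  rw [← inner_deltaTensor_left, orbitProj_apply, ← Submodule.inner_starProjection_left_eq_right,
    Submodule.starProjection_eq_self_iff.mpr (deltaTensor_const_mem hN g), inner_deltaTensor_left]
  by_cases hg : g = 1
  · rw [hg, deltaTensor_self, hφ]
  · rw [deltaTensor_of_ne hg, inner_zero_right]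

/-- Both sides are the trace of `E(f')* f E(φ) u_g*`, for `E` the conditional expectation
onto `P`. -/
theorem tsum_inner_orbitProj (hN : groupVN Γ μ ≤ P) (hM : P ≤ crossedProduct Γ μ)
    (f f' : Lp ℂ ∞ μ) (φ : Lp ℂ 2 μ) (g : Γ) :
    ∑' k, ⟪orbitProj P (mulLInfty μ f' (Lp.const 2 μ (1 : ℂ))) (k * g⁻¹),
        mulLInfty μ f (orbitProj P φ k)⟫_ℂ =
      ∑' k, ⟪mulLInfty μ f' (orbitProj P (koopman μ g (conjLTwo μ φ)) (k * g⁻¹)),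
        orbitProj P (mulLInfty μ f (Lp.const 2 μ (1 : ℂ))) k⟫_ℂ := by
  have inner_eq := isModularConjugation_crossedConj.inner_starProjection hM
    (mul_mem (crossedFunction_mem_crossedProduct f') (crossedUnitary_mem_crossedProduct g))
    (crossedFunction_mem_crossedProduct f) (orbitProj_mem (P := P) φ)
  rw [mul_apply_eq_comp, mul_apply_eq_comp, crossedUnitary_crossedVector,
    crossedFunction_deltaTensor, crossedConj_orbitProj hM, crossedFunction_crossedVector,
    ← orbitProj_apply, lp.inner_eq_tsum, lp.inner_eq_tsum] at inner_eq
  simpa only [starProjection_deltaTensor hN hM, crossedFunction_apply, crossedUnitary_apply,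
    orbitProj_koopman hN hM, mul_assoc, inv_mul_cancel, mul_one] using inner_eq

theorem eq_crossedProduct_of_orbitProj_eq (hN : groupVN Γ μ ≤ P)
    (hM : P ≤ crossedProduct Γ μ) (h : ∀ φ, orbitProj P φ = deltaTensor 1 φ) :
    P = crossedProduct Γ μ := by
  refine le_antisymm hM ((vonNeumannClosure_le_iff _ _).mpr (Set.union_subset ?_ ?_))
  · rintro _ ⟨f, rfl⟩
    refine isModularConjugation_crossedConj.mem_of_apply_mem hM
      (crossedFunction_mem_crossedProduct f) ?_
    rw [crossedFunction_crossedVector, ← h]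
    exact orbitProj_mem _
  · rintro _ ⟨s, rfl⟩
    exact hN (crossedUnitary_mem_groupVN s)

theorem eq_groupVN_of_orbitProj_eq_smul (hN : groupVN Γ μ ≤ P) (hM : P ≤ crossedProduct Γ μ)
    (h : ∀ φ, ∃ c : ℂ, orbitProj P φ = c • crossedVector Γ μ) : P = groupVN Γ μ := by
  refine le_antisymm (isModularConjugation_crossedConj.le_of_orbitClosure_le hM
    groupVN_le_crossedProduct fun η hη => ?_) hN
  have starProjection_mem (g : Γ) (φ : Lp ℂ 2 μ) :
      (orbitClosure P (crossedVector Γ μ)).starProjection (deltaTensor g φ) ∈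
        orbitClosure (groupVN Γ μ) (crossedVector Γ μ) := by
    obtain ⟨c, hc⟩ := h φ
    have : (orbitClosure P (crossedVector Γ μ)).starProjection (deltaTensor g φ) =
        c • deltaTensor g (Lp.const 2 μ (1 : ℂ)) := by
      ext1; funext k
      rw [starProjection_deltaTensor hN hM, hc, lp.coeFn_smul, lp.coeFn_smul, Pi.smul_apply,
        Pi.smul_apply, crossedVector]
      by_cases hk : k = g
      · rw [hk, mul_inv_cancel, deltaTensor_self, deltaTensor_self]
      · rw [deltaTensor_of_ne hk, deltaTensor_of_ne (mt mul_inv_eq_one.mp hk)]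
    rw [this]
    exact Submodule.smul_mem _ c (deltaTensor_const_mem le_rfl g)
  have hsum := (hasSum_deltaTensor η).mapL (orbitClosure P (crossedVector Γ μ)).starProjection
  rw [Submodule.starProjection_eq_self_iff.mpr hη] at hsum
  exact orbitClosure.isClosed.mem_of_tendsto hsum
    (Filter.Eventually.of_forall fun s => Submodule.sum_mem _ fun g _ => starProjection_mem g _)

theorem starProjection_span_const_koopman (s : Γ) (φ : Lp ℂ 2 μ) :
    (ℂ ∙ Lp.const 2 μ (1 : ℂ)).starProjection (koopman μ s φ) =
      koopman μ s ((ℂ ∙ Lp.const 2 μ (1 : ℂ)).starProjection φ) := by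
  refine starProjection_map_comm _ (koopman μ s) (fun ψ hψ => ?_) (fun ψ hψ => ?_) φ
  · obtain ⟨c, rfl⟩ := Submodule.mem_span_singleton.mp hψ
    rw [map_smul, koopman_const]
    exact Submodule.smul_mem _ c (Submodule.mem_span_singleton_self _)
  · rw [Submodule.mem_orthogonal_singleton_iff_inner_right] at hψ ⊢
    rw [← koopman_const s, inner_koopman_koopman, hψ]

theorem apply_crossedVector_mem_span_const {x : EllTwo Γ (Lp ℂ 2 μ) →L[ℂ] EllTwo Γ (Lp ℂ 2 μ)}
    (hx : x ∈ groupVN Γ μ) (g : Γ) : x (crossedVector Γ μ) g ∈ ℂ ∙ Lp.const 2 μ (1 : ℂ) := by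
  set e := (ℂ ∙ Lp.const 2 μ (1 : ℂ)).starProjection
  have mem_commutant : tensorShift e (1 : Γ) ∈ (groupVN Γ μ).commutant := by
    refine mem_commutant_vonNeumannClosure ?_ ?_ <;> rintro _ ⟨s, rfl⟩
    · exact ⟨s⁻¹, (star_crossedUnitary s).symm⟩
    · ext ξ : 1
      ext1; funext k
      rw [mul_apply_eq_comp, mul_apply_eq_comp, crossedUnitary_apply, tensorShift_apply,
        tensorShift_apply, crossedUnitary_apply, starProjection_span_const_koopman, inv_one,
        one_mul, one_mul]
  have map_vector : tensorShift e (1 : Γ) (crossedVector Γ μ) = crossedVector Γ μ := by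
    rw [crossedVector, tensorShift_deltaTensor, one_mul, Submodule.starProjection_eq_self_iff.mpr
      (Submodule.mem_span_singleton_self _)]
  have := apply_apply_of_mem_commutant mem_commutant hx (crossedVector Γ μ)
  rw [← Submodule.starProjection_eq_self_iff]
  conv_rhs => rw [← map_vector, this, tensorShift_apply, inv_one, one_mul]

theorem mulLInfty_const_mem_span_of_crossedFunction_mem_groupVN {f : Lp ℂ ∞ μ}
    (h : crossedFunction Γ μ f ∈ groupVN Γ μ) :
    mulLInfty μ f (Lp.const 2 μ (1 : ℂ)) ∈ ℂ ∙ Lp.const 2 μ (1 : ℂ) := by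
  simpa only [crossedFunction_crossedVector, deltaTensor_self] using
    apply_crossedVector_mem_span_const h 1

end OrbitProj

/-! ### Transvections -/

section Transvections

variable {K : Type*} [Field K]

/-- The determinant of the matrix with columns `v` and `w`, that is, the standard symplectic form
on `K²`. -/
def wedge (v w : Fin 2 → K) : K := v 0 * w 1 - v 1 * w 0

theorem wedge_self (v : Fin 2 → K) : wedge v v = 0 := by
  unfold wedge; ring

theorem wedge_comm (v w : Fin 2 → K) : wedge w v = -wedge v w := by
  unfold wedge; ring

theorem wedge_add_right (u v w : Fin 2 → K) : wedge u (v + w) = wedge u v + wedge u w := by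
  simp only [wedge, Pi.add_apply]; ring

theorem wedge_smul_left (c : K) (v w : Fin 2 → K) : wedge (c • v) w = c * wedge v w := by
  simp only [wedge, Pi.smul_apply, smul_eq_mul]; ring

theorem wedge_smul_right (c : K) (v w : Fin 2 → K) : wedge v (c • w) = c * wedge v w := by
  simp only [wedge, Pi.smul_apply, smul_eq_mul]; ring

theorem wedge_mulVec (s : SL(2, K)) (v w : Fin 2 → K) :
    wedge (s.1 *ᵥ v) (s.1 *ᵥ w) = wedge v w := by
  have hdet := s.2
  rw [Matrix.det_fin_two] at hdet
  simp only [wedge, Matrix.mulVec, dotProduct, Fin.sum_univ_two]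
  linear_combination (v 0 * w 1 - v 1 * w 0) * hdet

theorem exists_wedge_eq_one {v : Fin 2 → K} (hv : v ≠ 0) : ∃ w, wedge v w = 1 := by
  by_cases h0 : v 0 = 0
  · have h1 : v 1 ≠ 0 := fun h1 => hv (by ext i; fin_cases i <;> assumption)
    exact ⟨![-(v 1)⁻¹, 0], by simp [wedge, h1]⟩
  · exact ⟨![0, (v 0)⁻¹], by simp [wedge, h0]⟩

theorem eq_wedge_smul_add_wedge_smul {v w : Fin 2 → K} (h : wedge v w = 1) (u : Fin 2 → K) :
    u = wedge u w • v + wedge v u • w := by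
  unfold wedge at *
  ext i
  fin_cases i
  · change u 0 = (u 0 * w 1 - u 1 * w 0) * v 0 + (v 0 * u 1 - v 1 * u 0) * w 0
    linear_combination -u 0 * h
  · change u 1 = (u 0 * w 1 - u 1 * w 0) * v 1 + (v 0 * u 1 - v 1 * u 0) * w 1
    linear_combination -u 1 * h

theorem exists_eq_smul_of_wedge_eq_zero {v w : Fin 2 → K} (hv : v ≠ 0) (h : wedge v w = 0) :
    ∃ c : K, w = c • v := by
  obtain ⟨u, hu⟩ := exists_wedge_eq_one hv
  exact ⟨wedge w u, by simpa [h] using eq_wedge_smul_add_wedge_smul hu w⟩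

theorem eq_zero_of_wedge_eq_zero {u v w : Fin 2 → K} (hvw : wedge v w ≠ 0) (hv : wedge v u = 0)
    (hw : wedge w u = 0) : u = 0 := by
  obtain ⟨c, rfl⟩ := exists_eq_smul_of_wedge_eq_zero (fun h => hvw (by simp [h, wedge])) hv
  rw [wedge_smul_right, wedge_comm v w, mul_neg, neg_eq_zero] at hw
  rw [(mul_eq_zero_iff_right hvw).mp hw, zero_smul]

theorem exists_mulVec_eq {v : Fin 2 → K} (hv : v ≠ 0) : ∃ s : SL(2, K), s.1 *ᵥ ![1, 0] = v := by
  obtain ⟨w, hw⟩ := exists_wedge_eq_one hv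
  refine ⟨⟨!![v 0, w 0; v 1, w 1], ?_⟩, ?_⟩
  · rw [Matrix.det_fin_two_of, ← hw, wedge, mul_comm (w 0)]
  · ext i
    fin_cases i <;> simp [Matrix.mulVec, dotProduct]

theorem eq_of_forall_mulVec_eq {A B : SL(2, K)} (h : ∀ w, A.1 *ᵥ w = B.1 *ᵥ w) : A = B :=
  Subtype.ext (Matrix.toLin'.injective (LinearMap.ext h))

theorem coe_eq_coe_iff_eq_or_eq_neg {A B : SL(2, K)} :
    (A : PSL(2, K)) = B ↔ B = A ∨ B = -A := by
  rw [QuotientGroup.eq, Matrix.SpecialLinearGroup.mem_center_iff]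
  constructor
  · rintro ⟨r, hr, hAB⟩
    rw [Fintype.card_fin, sq_eq_one_iff] at hr
    rcases hr with rfl | rfl
    · left
      rw [← mul_inv_cancel_left A B, (Subtype.ext (by simp [← hAB]) : A⁻¹ * B = 1), mul_one]
    · right
      rw [← mul_inv_cancel_left A B, (Subtype.ext (by rw [← hAB, map_neg, map_one]; rfl) :
        A⁻¹ * B = -1), mul_neg_one]
  · rintro (rfl | rfl)
    · exact ⟨1, by simp⟩
    · exact ⟨-1, by simp, by rw [mul_neg, inv_mul_cancel, map_neg, map_one]; rfl⟩

theorem mulVec_eq_or_eq_neg_of_coe_eq {A B : SL(2, K)} (h : (A : PSL(2, K)) = B)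
    (v : Fin 2 → K) : B.1 *ᵥ v = A.1 *ᵥ v ∨ B.1 *ᵥ v = -(A.1 *ᵥ v) := by
  rcases coe_eq_coe_iff_eq_or_eq_neg.mp h with rfl | rfl
  · exact Or.inl rfl
  · exact Or.inr (by rw [Matrix.SpecialLinearGroup.coe_neg, Matrix.neg_mulVec])

/-- The transvection `w ↦ w + a (v ∧ w) v`, where `v ∧ w` is `wedge v w`. -/
def transvection (v : Fin 2 → K) (a : K) : SL(2, K) :=
  ⟨!![1 - a * v 0 * v 1, a * v 0 ^ 2; -(a * v 1 ^ 2), 1 + a * v 0 * v 1], by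
    rw [Matrix.det_fin_two_of]; ring⟩

theorem transvection_mulVec (v : Fin 2 → K) (a : K) (w : Fin 2 → K) :
    (transvection v a).1 *ᵥ w = w + (a * wedge v w) • v := by
  ext i
  fin_cases i <;> simp [transvection, Matrix.mulVec, dotProduct, wedge] <;> ring

theorem transvection_mulVec_self (v : Fin 2 → K) (a : K) : (transvection v a).1 *ᵥ v = v := by
  rw [transvection_mulVec, wedge_self, mul_zero, zero_smul, add_zero]

theorem transvection_mul_transvection (v : Fin 2 → K) (a b : K) :
    transvection v a * transvection v b = transvection v (a + b) := by
  refine eq_of_forall_mulVec_eq fun w => ?_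
  rw [Matrix.SpecialLinearGroup.coe_mul, ← Matrix.mulVec_mulVec]
  simp only [transvection_mulVec, wedge_add_right, wedge_smul_right, wedge_self]
  module

theorem transvection_zero (v : Fin 2 → K) : transvection v 0 = 1 := by
  refine eq_of_forall_mulVec_eq fun w => ?_
  rw [transvection_mulVec, zero_mul, zero_smul, add_zero, Matrix.SpecialLinearGroup.coe_one,
    Matrix.one_mulVec]

theorem transvection_inv (v : Fin 2 → K) (a : K) : (transvection v a)⁻¹ = transvection v (-a) := by
  rw [inv_eq_iff_mul_eq_one, transvection_mul_transvection, add_neg_cancel, transvection_zero]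

theorem coe_transvection_zero (v : Fin 2 → K) : (transvection v 0 : PSL(2, K)) = 1 :=
  congrArg _ (transvection_zero v)

theorem coe_transvection_mul_coe_transvection (v : Fin 2 → K) (a b : K) :
    (transvection v a : PSL(2, K)) * transvection v b = transvection v (a + b) :=
  congrArg _ (transvection_mul_transvection v a b)

theorem coe_transvection_inv (v : Fin 2 → K) (a : K) :
    (transvection v a : PSL(2, K))⁻¹ = transvection v (-a) :=
  congrArg _ (transvection_inv v a)

theorem mul_transvection (s : SL(2, K)) (v : Fin 2 → K) (a : K) :
    s * transvection v a = transvection (s.1 *ᵥ v) a * s := by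
  refine eq_of_forall_mulVec_eq fun w => ?_
  rw [Matrix.SpecialLinearGroup.coe_mul, Matrix.SpecialLinearGroup.coe_mul, ← Matrix.mulVec_mulVec,
    ← Matrix.mulVec_mulVec, transvection_mulVec, transvection_mulVec, wedge_mulVec,
    Matrix.mulVec_add, Matrix.mulVec_smul]

theorem transvection_smul (c : K) (v : Fin 2 → K) (a : K) :
    transvection (c • v) a = transvection v (c ^ 2 * a) := by
  refine eq_of_forall_mulVec_eq fun w => ?_
  rw [transvection_mulVec, transvection_mulVec, wedge_smul_left]
  module

theorem exists_eq_transvection_of_mulVec_eq {A : SL(2, K)} {v : Fin 2 → K} (hv : v ≠ 0)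
    (h : A.1 *ᵥ v = v) : ∃ a, A = transvection v a := by
  obtain ⟨w, hw⟩ := exists_wedge_eq_one hv
  obtain ⟨a, ha⟩ := exists_eq_smul_of_wedge_eq_zero (w := A.1 *ᵥ w - w) hv <| by
    rw [sub_eq_add_neg, ← neg_one_smul K, wedge_add_right, wedge_smul_right, ← wedge_mulVec A v w,
      h]
    ring
  rw [sub_eq_iff_eq_add] at ha
  refine ⟨a, eq_of_forall_mulVec_eq fun u => ?_⟩
  have u_eq := eq_wedge_smul_add_wedge_smul hw u
  calc A.1 *ᵥ u = A.1 *ᵥ (wedge u w • v + wedge v u • w) := by rw [← u_eq]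
    _ = wedge u w • v + wedge v u • (a • v + w) := by
      rw [Matrix.mulVec_add, Matrix.mulVec_smul, Matrix.mulVec_smul, h, ha]
    _ = (wedge u w • v + wedge v u • w) + (a * wedge v u) • v := by module
    _ = (transvection v a).1 *ᵥ u := by rw [← u_eq, transvection_mulVec]

theorem coe_transvection_mul_coe_transvection_ne {v w z : Fin 2 → K} {b : K}
    (h₀ : b * wedge v z * wedge v w ≠ 0) (h₂ : b * wedge v z * wedge v w ≠ 2 * wedge w z)
    (m c : K) :
    (transvection w m : PSL(2, K)) * transvection v b ≠ transvection z c := by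
  intro h
  have wedge_mulVec_eq : wedge w ((transvection w m * transvection v b).1 *ᵥ z) =
      wedge w z - b * wedge v z * wedge v w := by
    rw [Matrix.SpecialLinearGroup.coe_mul, ← Matrix.mulVec_mulVec, transvection_mulVec w,
      transvection_mulVec, wedge_add_right, wedge_smul_right, wedge_self, wedge_add_right,
      wedge_smul_right, wedge_comm v w]
    ring
  rcases mulVec_eq_or_eq_neg_of_coe_eq
    (A := transvection z c) (B := transvection w m * transvection v b) h.symm z with hz | hz <;>
    rw [hz, transvection_mulVec_self] at wedge_mulVec_eq
  · exact h₀ (by linear_combination wedge_mulVec_eq)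
  · rw [← neg_one_smul K z, wedge_smul_right] at wedge_mulVec_eq
    exact h₂ (by linear_combination wedge_mulVec_eq)

theorem trace_transvection (v : Fin 2 → K) (a : K) : (transvection v a).1.trace = 2 := by
  rw [transvection, Matrix.trace_fin_two_of]
  ring

variable [NeZero (2 : K)]

theorem transvection_eq_of_coe_eq {v w : Fin 2 → K} {a b : K}
    (h : (transvection v a : PSL(2, K)) = transvection w b) :
    transvection v a = transvection w b := by
  rcases coe_eq_coe_iff_eq_or_eq_neg.mp h with h | h
  · exact h.symm
  · have trace_eq := trace_transvection w b
    rw [h, Matrix.SpecialLinearGroup.coe_neg, Matrix.trace_neg, trace_transvection] at trace_eq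
    exact absurd (by linear_combination -trace_eq) (mul_self_ne_zero.mpr (NeZero.ne (2 : K)))

theorem eq_zero_of_coe_transvection_eq {v w : Fin 2 → K} (hvw : wedge v w ≠ 0) {a b : K}
    (h : (transvection v a : PSL(2, K)) = transvection w b) : a = 0 := by
  have apply_eq := congrArg (fun A : SL(2, K) => A.1 *ᵥ w) (transvection_eq_of_coe_eq h)
  simp only [transvection_mulVec_self, transvection_mulVec, add_eq_left, smul_eq_zero,
    mul_eq_zero] at apply_eq
  rcases apply_eq with (ha | h0) | rfl
  · exact ha
  · exact absurd h0 hvw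
  · simp [wedge] at hvw

theorem exists_eq_transvection_of_commute {g : PSL(2, K)} {v : Fin 2 → K} (hv : v ≠ 0) {t : K}
    (ht : t ≠ 0) (h : Commute g (transvection v t : PSL(2, K))) :
    ∃ a, g = (transvection v a : PSL(2, K)) := by
  obtain ⟨A, rfl⟩ := QuotientGroup.mk_surjective g
  have conj_eq : transvection (A.1 *ᵥ v) t = transvection v t := by
    refine transvection_eq_of_coe_eq (mul_right_cancel (b := (A : PSL(2, K))) ?_)
    exact (congrArg _ (mul_transvection A v t).symm).trans h.eq
  obtain ⟨c, hc⟩ : ∃ c : K, A.1 *ᵥ v = c • v := by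
    refine exists_eq_smul_of_wedge_eq_zero hv (by_contra fun hne => ht ?_)
    exact eq_zero_of_coe_transvection_eq hne (congrArg _ conj_eq.symm)
  have sq_eq : c ^ 2 * t + -t = 0 := by
    obtain ⟨w, hw⟩ := exists_wedge_eq_one hv
    rw [hc, transvection_smul, ← mul_inv_eq_one, transvection_inv,
      transvection_mul_transvection, ← transvection_zero w] at conj_eq
    exact eq_zero_of_coe_transvection_eq (by rw [hw]; exact one_ne_zero) (congrArg _ conj_eq)
  have c_eq : c = 1 ∨ c = -1 :=
    sq_eq_one_iff.mp (mul_right_cancel₀ ht (by linear_combination sq_eq))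
  rcases c_eq with rfl | rfl
  · obtain ⟨a, rfl⟩ := exists_eq_transvection_of_mulVec_eq hv (hc.trans (one_smul _ v))
    exact ⟨a, rfl⟩
  · obtain ⟨a, ha⟩ := exists_eq_transvection_of_mulVec_eq (A := -A) hv (by
      rw [Matrix.SpecialLinearGroup.coe_neg, Matrix.neg_mulVec, hc, neg_one_smul, neg_neg])
    exact ⟨a, coe_eq_coe_iff_eq_or_eq_neg.mpr (Or.inr ha.symm)⟩

end Transvections

/-! ### Fourier coefficients along lines -/

section FourierLines

theorem inner_cosLTwo_koopman (s : SL(2, ℚ)) (z : Fin 2 → ℚ) (φ : Lp ℂ 2 DualQuot.measure) :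
    ⟪cosLTwo (s.1 *ᵥ z), koopman DualQuot.measure (s : PSL(2, ℚ)) φ⟫_ℂ = ⟪cosLTwo z, φ⟫_ℂ := by
  rw [← koopman_cosLTwo, inner_koopman_koopman]

theorem inner_mulLInfty_cosLInfty (z : Fin 2 → ℚ) (φ ψ : Lp ℂ 2 DualQuot.measure) :
    ⟪mulLInfty DualQuot.measure (cosLInfty z) φ, ψ⟫_ℂ =
      ⟪φ, mulLInfty DualQuot.measure (cosLInfty z) ψ⟫_ℂ := by
  rw [← ContinuousLinearMap.adjoint_inner_right, ← ContinuousLinearMap.star_eq_adjoint,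
    star_mulLInfty, star_cosLInfty]

theorem summable_norm_sq_inner_cosLTwo (φ : Lp ℂ 2 DualQuot.measure) :
    Summable fun z => ‖⟪cosLTwo z, φ⟫_ℂ‖ ^ 2 := by
  refine (hasSum_inner_cosLTwo φ φ).summable.norm.congr fun z => ?_
  rw [norm_mul, norm_inner_symm, sq]

theorem inner_cosLTwo_smul_self {v : Fin 2 → ℚ} (hv : v ≠ 0) (t : ℚ) :
    ⟪cosLTwo (t • v), cosLTwo v⟫_ℂ =
      2 * ((if t = 1 then 1 else 0) + if t = -1 then 1 else 0) := by
  have smul_eq_iff (c : ℚ) : t • v = c • v ↔ t = c := (smul_left_injective ℚ hv).eq_iff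
  simp only [inner_cosLTwo_cosLTwo, ← smul_eq_iff, one_smul, neg_smul]

/-- The Fourier transform of `φ` vanishes outside the line spanned by `v` (for `v ≠ 0`). -/
def FourierSupportedOnLine (v : Fin 2 → ℚ) (φ : Lp ℂ 2 DualQuot.measure) : Prop :=
  ∀ z, wedge v z ≠ 0 → ⟪cosLTwo z, φ⟫_ℂ = 0

theorem fourierSupportedOnLine_cosLTwo (v : Fin 2 → ℚ) : FourierSupportedOnLine v (cosLTwo v) := by
  intro z hz
  have ne_smul (c : ℚ) : z ≠ c • v := fun h =>
    hz (by rw [h, wedge_smul_right, wedge_self, mul_zero])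
  rw [inner_cosLTwo_cosLTwo, if_neg (by simpa using ne_smul 1),
    if_neg (by simpa using ne_smul (-1)), add_zero, mul_zero]

namespace FourierSupportedOnLine

variable {v w : Fin 2 → ℚ} {φ ψ : Lp ℂ 2 DualQuot.measure}

theorem const_smul (hφ : FourierSupportedOnLine v φ) (c : ℂ) : FourierSupportedOnLine v (c • φ) :=
  fun z hz => by rw [inner_smul_right, hφ z hz, mul_zero]

theorem eq_of_forall_inner_eq (hφ : FourierSupportedOnLine v φ) (hψ : FourierSupportedOnLine v ψ)
    (hv : v ≠ 0) (h : ∀ t : ℚ, ⟪cosLTwo (t • v), φ⟫_ℂ = ⟪cosLTwo (t • v), ψ⟫_ℂ) : φ = ψ := by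
  refine ext_inner_cosLTwo fun z => ?_
  by_cases hz : wedge v z = 0
  · obtain ⟨t, rfl⟩ := exists_eq_smul_of_wedge_eq_zero hv hz
    exact h t
  · rw [hφ z hz, hψ z hz]

theorem hasSum_inner_mul_inner (hφ : FourierSupportedOnLine v φ)
    (hψ : FourierSupportedOnLine w ψ) (hvw : wedge v w ≠ 0) (q s : ℚ) :
    HasSum (fun y => ⟪ψ, cosLTwo (y + (q • v + s • w))⟫_ℂ * ⟪cosLTwo y, φ⟫_ℂ)
      (⟪ψ, cosLTwo (s • w)⟫_ℂ * ⟪cosLTwo (q • v), φ⟫_ℂ) := by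
  convert hasSum_single (-(q • v)) fun y hy => ?_ using 1
  · rw [cosLTwo_neg, neg_add_cancel_left]
  · rw [mul_eq_zero, or_iff_not_imp_right]
    intro hy_inner
    rw [← inner_conj_symm, hψ, map_zero]
    refine fun hw => hy (eq_neg_of_add_eq_zero_left (eq_zero_of_wedge_eq_zero hvw ?_ ?_))
    · rw [wedge_add_right, wedge_smul_right, wedge_self, mul_zero, add_zero]
      exact not_imp_comm.mp (hφ y) hy_inner
    · rwa [← add_assoc, wedge_add_right, wedge_smul_right s, wedge_self, mul_zero, add_zero] at hw

theorem inner_mulLInfty (hφ : FourierSupportedOnLine v φ) (hψ : FourierSupportedOnLine w ψ)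
    (hvw : wedge v w ≠ 0) (q s : ℚ) :
    ⟪mulLInfty DualQuot.measure (cosLInfty (q • v + s • w)) ψ, φ⟫_ℂ =
      2⁻¹ * (⟪ψ, cosLTwo (s • w)⟫_ℂ * ⟪cosLTwo (q • v), φ⟫_ℂ) := by
  have parseval := hasSum_inner_cosLTwo
    (mulLInfty DualQuot.measure (cosLInfty (q • v + s • w)) ψ) φ
  have hasSum_add := (hφ.hasSum_inner_mul_inner hψ hvw q s).add
    (hφ.hasSum_inner_mul_inner hψ hvw (-q) (-s))
  simp only [show -q • v + -s • w = -(q • v + s • w) by module, ← sub_eq_add_neg] at hasSum_add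
  simp only [neg_smul, cosLTwo_neg] at hasSum_add
  simp only [inner_mulLInfty_cosLInfty, mulLInfty_cosLTwo, inner_add_right, add_mul] at parseval
  rw [inner_mulLInfty_cosLInfty]
  linear_combination (4 : ℂ)⁻¹ * parseval.unique hasSum_add

end FourierSupportedOnLine

end FourierLines

/-! ### Coefficients of the projection -/

section OrbitCoeff

variable {P : VonNeumannAlgebra (EllTwo PSL(2, ℚ) (Lp ℂ 2 DualQuot.measure))}

theorem orbitProj_cosLTwo_mulVec (hN : groupVN PSL(2, ℚ) DualQuot.measure ≤ P)
    (hM : P ≤ crossedProduct PSL(2, ℚ) DualQuot.measure) (s : SL(2, ℚ)) (v : Fin 2 → ℚ)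
    (g : PSL(2, ℚ)) :
    orbitProj P (cosLTwo (s.1 *ᵥ v)) g = koopman DualQuot.measure (s : PSL(2, ℚ))
      (orbitProj P (cosLTwo v) ((s : PSL(2, ℚ))⁻¹ * g * s)) := by
  rw [← koopman_cosLTwo, orbitProj_koopman hN hM]

theorem orbitProj_cosLTwo_mulVec_transvection (hN : groupVN PSL(2, ℚ) DualQuot.measure ≤ P)
    (hM : P ≤ crossedProduct PSL(2, ℚ) DualQuot.measure) (s : SL(2, ℚ)) (v : Fin 2 → ℚ) (a : ℚ) :
    orbitProj P (cosLTwo (s.1 *ᵥ v)) (transvection (s.1 *ᵥ v) a : PSL(2, ℚ)) =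
      koopman DualQuot.measure (s : PSL(2, ℚ))
        (orbitProj P (cosLTwo v) (transvection v a : PSL(2, ℚ))) := by
  have conj_eq : (s : PSL(2, ℚ))⁻¹ * transvection (s.1 *ᵥ v) a * s = transvection v a := by
    rw [mul_assoc, inv_mul_eq_iff_eq_mul]
    exact congrArg _ (mul_transvection s v a).symm
  rw [orbitProj_cosLTwo_mulVec hN hM, conj_eq]

theorem norm_orbitProj_cosLTwo_conj_transvection (hN : groupVN PSL(2, ℚ) DualQuot.measure ≤ P)
    (hM : P ≤ crossedProduct PSL(2, ℚ) DualQuot.measure) (v : Fin 2 → ℚ) (t : ℚ) (g : PSL(2, ℚ)) :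
    ‖orbitProj P (cosLTwo v)
      ((transvection v t : PSL(2, ℚ)) * g * (transvection v t : PSL(2, ℚ))⁻¹)‖ =
      ‖orbitProj P (cosLTwo v) g‖ := by
  have apply_eq := orbitProj_cosLTwo_mulVec hN hM (transvection v t) v
    ((transvection v t : PSL(2, ℚ)) * g * (transvection v t : PSL(2, ℚ))⁻¹)
  rw [transvection_mulVec_self] at apply_eq
  rw [apply_eq, norm_koopman, mul_assoc _ g, inv_mul_cancel_left, inv_mul_cancel_right]

/-- Square summability forces the orbit of `g` under conjugation by the transvections fixing `v`,
on which `‖orbitProj P (cosLTwo v)‖` is constant, to be finite. -/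
theorem exists_eq_transvection_of_orbitProj_ne_zero
    (hN : groupVN PSL(2, ℚ) DualQuot.measure ≤ P)
    (hM : P ≤ crossedProduct PSL(2, ℚ) DualQuot.measure) {v : Fin 2 → ℚ} (hv : v ≠ 0)
    {g : PSL(2, ℚ)} (hg : orbitProj P (cosLTwo v) g ≠ 0) :
    ∃ a, g = (transvection v a : PSL(2, ℚ)) := by
  obtain ⟨m, n, hmn, conj_eq⟩ := exists_lt_eq_of_summable
    (summable_norm_sq_ellTwo (orbitProj P (cosLTwo v))) (pow_ne_zero 2 (norm_ne_zero_iff.mpr hg))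
    (fun n : ℕ => (transvection v n : PSL(2, ℚ)) * g * (transvection v n : PSL(2, ℚ))⁻¹)
    fun n => by rw [norm_orbitProj_cosLTwo_conj_transvection hN hM]
  refine exists_eq_transvection_of_commute hv (t := n - m)
    (sub_ne_zero.mpr (by exact_mod_cast hmn.ne')) ?_
  have transvection_eq : (transvection v (n - m) : PSL(2, ℚ)) =
      (transvection v (m : ℚ) : PSL(2, ℚ))⁻¹ * transvection v (n : ℚ) := by
    rw [coe_transvection_inv, coe_transvection_mul_coe_transvection, neg_add_eq_sub]
  rw [eq_mul_inv_iff_mul_eq] at conj_eq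
  rw [transvection_eq, commute_iff_eq, mul_assoc, ← conj_eq]
  group

theorem fourierSupportedOnLine_orbitProj (hN : groupVN PSL(2, ℚ) DualQuot.measure ≤ P)
    (hM : P ≤ crossedProduct PSL(2, ℚ) DualQuot.measure) (v : Fin 2 → ℚ) (a : ℚ) :
    FourierSupportedOnLine v (orbitProj P (cosLTwo v) (transvection v a : PSL(2, ℚ))) := by
  set φ := orbitProj P (cosLTwo v) (transvection v a : PSL(2, ℚ)) with φ_def
  have inner_mulVec (n : ℕ) (z : Fin 2 → ℚ) :
      ⟪cosLTwo ((transvection v n).1 *ᵥ z), φ⟫_ℂ = ⟪cosLTwo z, φ⟫_ℂ := by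
    have koopman_eq := orbitProj_cosLTwo_mulVec_transvection hN hM (transvection v n) v a
    rw [transvection_mulVec_self, ← φ_def] at koopman_eq
    conv_lhs => rw [koopman_eq, inner_cosLTwo_koopman]
  refine fun z hz => by_contra fun h => ?_
  obtain ⟨m, n, hmn, mulVec_eq⟩ := exists_lt_eq_of_summable (summable_norm_sq_inner_cosLTwo φ)
    (pow_ne_zero 2 (norm_ne_zero_iff.mpr h)) (fun n : ℕ => (transvection v n).1 *ᵥ z)
    fun n => by rw [inner_mulVec]
  have hv : v ≠ 0 := fun h0 => hz (by simp [h0, wedge])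
  rw [transvection_mulVec, transvection_mulVec, add_right_inj, (smul_left_injective ℚ hv).eq_iff,
    mul_left_inj' hz, Nat.cast_inj] at mulVec_eq
  exact hmn.ne mulVec_eq

theorem inner_cosLTwo_zero_orbitProj (hN : groupVN PSL(2, ℚ) DualQuot.measure ≤ P)
    {v : Fin 2 → ℚ} (hv : v ≠ 0) (g : PSL(2, ℚ)) :
    ⟪cosLTwo 0, orbitProj P (cosLTwo v) g⟫_ℂ = 0 := by
  have inner_eq := inner_cosLTwo_smul_self hv 0
  simp only [zero_smul, cosLTwo_zero, inner_smul_left] at inner_eq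
  rw [cosLTwo_zero, inner_smul_left, inner_const_orbitProj hN (by simpa using inner_eq), mul_zero]

/-- The Fourier coefficient at `t • v` of `orbitProj P (cosLTwo v) [transvection v a]`, which does
not depend on the choice of `v ≠ 0` (see `inner_cosLTwo_smul_orbitProj`). -/
def orbitCoeff (P : VonNeumannAlgebra (EllTwo PSL(2, ℚ) (Lp ℂ 2 DualQuot.measure))) (a t : ℚ) : ℂ :=
  ⟪cosLTwo (t • ![1, 0]), orbitProj P (cosLTwo ![1, 0]) (transvection ![1, 0] a : PSL(2, ℚ))⟫_ℂ

theorem inner_cosLTwo_smul_orbitProj (hN : groupVN PSL(2, ℚ) DualQuot.measure ≤ P)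
    (hM : P ≤ crossedProduct PSL(2, ℚ) DualQuot.measure) {v : Fin 2 → ℚ} (hv : v ≠ 0) (a t : ℚ) :
    ⟪cosLTwo (t • v), orbitProj P (cosLTwo v) (transvection v a : PSL(2, ℚ))⟫_ℂ =
      orbitCoeff P a t := by
  obtain ⟨s, rfl⟩ := exists_mulVec_eq hv
  rw [orbitProj_cosLTwo_mulVec_transvection hN hM, ← Matrix.mulVec_smul, inner_cosLTwo_koopman,
    orbitCoeff]

theorem orbitCoeff_neg (a t : ℚ) : orbitCoeff P a (-t) = orbitCoeff P a t := by
  rw [orbitCoeff, neg_smul, cosLTwo_neg, orbitCoeff]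

theorem orbitCoeff_zero (hN : groupVN PSL(2, ℚ) DualQuot.measure ≤ P) (a : ℚ) :
    orbitCoeff P a 0 = 0 := by
  rw [orbitCoeff, zero_smul, inner_cosLTwo_zero_orbitProj hN (by simp)]

theorem summable_norm_sq_orbitCoeff (a : ℚ) : Summable fun t => ‖orbitCoeff P a t‖ ^ 2 :=
  (summable_norm_sq_inner_cosLTwo _).comp_injective
    (smul_left_injective ℚ (by simp : (![1, 0] : Fin 2 → ℚ) ≠ 0))

end OrbitCoeff

section Rigidity

variable {P : VonNeumannAlgebra (EllTwo PSL(2, ℚ) (Lp ℂ 2 DualQuot.measure))}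

theorem tsum_inner_orbitProj_cosLTwo (hN : groupVN PSL(2, ℚ) DualQuot.measure ≤ P)
    (hM : P ≤ crossedProduct PSL(2, ℚ) DualQuot.measure) (v w z : Fin 2 → ℚ) (s : SL(2, ℚ)) :
    ∑' k, ⟪orbitProj P (cosLTwo z) (k * (s : PSL(2, ℚ))⁻¹),
        mulLInfty DualQuot.measure (cosLInfty v) (orbitProj P (cosLTwo w) k)⟫_ℂ =
      ∑' k, ⟪mulLInfty DualQuot.measure (cosLInfty z)
          (orbitProj P (cosLTwo (s.1 *ᵥ w)) (k * (s : PSL(2, ℚ))⁻¹)),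
        orbitProj P (cosLTwo v) k⟫_ℂ := by
  have trace_eq := tsum_inner_orbitProj hN hM (cosLInfty v) (cosLInfty z) (cosLTwo w) s
  rwa [conjLTwo_cosLTwo, koopman_cosLTwo] at trace_eq

/-- Only the term at `k = transvection v a` survives: a product of transvections along two
independent vectors is not a transvection along one of them. -/
theorem tsum_inner_mulLInfty_orbitProj (hN : groupVN PSL(2, ℚ) DualQuot.measure ≤ P)
    (hM : P ≤ crossedProduct PSL(2, ℚ) DualQuot.measure) {v w : Fin 2 → ℚ} (hvw : wedge v w ≠ 0)
    (a b q s : ℚ) :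
    ∑' k, ⟪mulLInfty DualQuot.measure (cosLInfty (q • v + s • w)) (orbitProj P (cosLTwo w)
        (k * ((transvection v a : PSL(2, ℚ))⁻¹ * (transvection w b : PSL(2, ℚ))))),
      orbitProj P (cosLTwo v) k⟫_ℂ = 2⁻¹ * (conj (orbitCoeff P b s) * orbitCoeff P a q) := by
  have hv : v ≠ 0 := fun h => hvw (by simp [h, wedge])
  have hw : w ≠ 0 := fun h => hvw (by simp [h, wedge])
  rw [tsum_eq_single (transvection v a : PSL(2, ℚ)) fun k hk => ?_, mul_inv_cancel_left,
    (fourierSupportedOnLine_orbitProj hN hM v a).inner_mulLInfty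
      (fourierSupportedOnLine_orbitProj hN hM w b) hvw, ← inner_conj_symm,
    inner_cosLTwo_smul_orbitProj hN hM hw, inner_cosLTwo_smul_orbitProj hN hM hv]
  by_contra h
  obtain ⟨c, rfl⟩ := exists_eq_transvection_of_orbitProj_ne_zero hN hM hv
    fun h0 => h (by rw [h0, inner_zero_right])
  obtain ⟨d, hd⟩ := exists_eq_transvection_of_orbitProj_ne_zero hN hM hw
    fun h0 => h (by rw [h0, map_zero, inner_zero_left])
  rw [← mul_assoc, ← eq_mul_inv_iff_mul_eq, coe_transvection_inv, coe_transvection_inv,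
    coe_transvection_mul_coe_transvection, coe_transvection_mul_coe_transvection] at hd
  rw [add_neg_eq_zero.mp (eq_zero_of_coe_transvection_eq hvw hd)] at hk
  exact hk rfl

theorem tsum_inner_orbitProj_mulLInfty_eq_zero (hN : groupVN PSL(2, ℚ) DualQuot.measure ≤ P)
    (hM : P ≤ crossedProduct PSL(2, ℚ) DualQuot.measure) {v w z : Fin 2 → ℚ} {b : ℚ}
    (h₀ : b * wedge v z * wedge v w ≠ 0) (h₂ : b * wedge v z * wedge v w ≠ 2 * wedge w z) (a : ℚ)
    (f : Lp ℂ ∞ DualQuot.measure) :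
    ∑' k, ⟪orbitProj P (cosLTwo z)
        (k * ((transvection w a : PSL(2, ℚ)) * (transvection v b : PSL(2, ℚ)))),
      mulLInfty DualQuot.measure f (orbitProj P (cosLTwo w) k)⟫_ℂ = 0 := by
  have hw : w ≠ 0 := fun h => h₀ (by simp [h, wedge])
  have hz : z ≠ 0 := fun h => h₀ (by simp [h, wedge])
  refine (tsum_congr fun k => by_contra fun h => ?_).trans tsum_zero
  obtain ⟨m, rfl⟩ := exists_eq_transvection_of_orbitProj_ne_zero hN hM hw
    fun h0 => h (by rw [h0, map_zero, inner_zero_right])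
  obtain ⟨c, hc⟩ := exists_eq_transvection_of_orbitProj_ne_zero hN hM hz
    fun h0 => h (by rw [h0, inner_zero_left])
  rw [← mul_assoc, coe_transvection_mul_coe_transvection] at hc
  exact coe_transvection_mul_coe_transvection_ne h₀ h₂ _ _ hc

theorem conj_orbitCoeff_mul_orbitCoeff_eq_zero (hN : groupVN PSL(2, ℚ) DualQuot.measure ≤ P)
    (hM : P ≤ crossedProduct PSL(2, ℚ) DualQuot.measure) {a q s : ℚ} (hs : a * s ≠ 0)
    (hq : 2 * q + a * s ≠ 0) : conj (orbitCoeff P a s) * orbitCoeff P a q = 0 := by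
  obtain ⟨v, w, hvw⟩ : ∃ v w : Fin 2 → ℚ, wedge v w = 1 := ⟨![1, 0], ![0, 1], by simp [wedge]⟩
  set u := (transvection v a).1 *ᵥ w with u_def
  set g := transvection v a * transvection w (-a) with g_def
  have u_eq : u = w + a • v := by rw [u_def, transvection_mulVec, hvw, mul_one]
  have wedge_v_u : wedge v u = 1 := by
    rw [u_eq, wedge_add_right, wedge_smul_right, wedge_self, hvw, mul_zero, add_zero]
  have wedge_v_z : wedge v (q • v + s • u) = s := by
    rw [wedge_add_right, wedge_smul_right, wedge_smul_right, wedge_self, wedge_v_u]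
    ring
  have wedge_w_z : wedge w (q • v + s • u) = -(q + a * s) := by
    simp only [u_eq, wedge_add_right, wedge_smul_right, wedge_self, wedge_comm v w, hvw]
    ring
  have mulVec_w : g.1 *ᵥ w = u := by
    rw [g_def, Matrix.SpecialLinearGroup.coe_mul, ← Matrix.mulVec_mulVec, transvection_mulVec_self]
  have inv_eq_left : (g : PSL(2, ℚ))⁻¹ =
      (transvection w a : PSL(2, ℚ)) * (transvection v (-a) : PSL(2, ℚ)) :=
    congrArg _ (by rw [g_def, mul_inv_rev, transvection_inv, transvection_inv, neg_neg] :
      g⁻¹ = transvection w a * transvection v (-a))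
  have inv_eq_right : (g : PSL(2, ℚ))⁻¹ =
      (transvection v a : PSL(2, ℚ))⁻¹ * (transvection u a : PSL(2, ℚ)) := by
    rw [inv_eq_left, ← coe_transvection_inv, eq_inv_mul_iff_mul_eq, ← mul_assoc,
      mul_inv_eq_iff_eq_mul]
    exact congrArg _ (mul_transvection (transvection v a) w a)
  have trace_eq := tsum_inner_orbitProj_cosLTwo hN hM v w (q • v + s • u) g
  rw [mulVec_w, inv_eq_left, tsum_inner_orbitProj_mulLInfty_eq_zero hN hM, ← inv_eq_left,
    inv_eq_right, tsum_inner_mulLInfty_orbitProj hN hM (by rw [wedge_v_u]; exact one_ne_zero)]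
    at trace_eq
  · simpa using trace_eq.symm
  · rw [wedge_v_z, hvw]
    exact fun h => hs (by linear_combination -h)
  · rw [wedge_v_z, wedge_w_z, hvw]
    exact fun h => hq (by linear_combination h)

theorem orbitCoeff_eq_zero (hN : groupVN PSL(2, ℚ) DualQuot.measure ≤ P)
    (hM : P ≤ crossedProduct PSL(2, ℚ) DualQuot.measure) {a : ℚ} (ha : a ≠ 0) (q : ℚ) :
    orbitCoeff P a q = 0 := by
  rcases eq_or_ne q 0 with rfl | hq
  · exact orbitCoeff_zero hN a
  suffices conj (orbitCoeff P a q) * orbitCoeff P a q = 0 by simpa using this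
  rcases eq_or_ne a (-2) with rfl | h₂
  · rw [← conj_orbitCoeff_mul_orbitCoeff_eq_zero hN hM (a := -2) (q := q) (s := -q)
      (mul_ne_zero ha (neg_ne_zero.mpr hq)) (by simpa [← two_mul] using hq), orbitCoeff_neg]
  · refine conj_orbitCoeff_mul_orbitCoeff_eq_zero hN hM (mul_ne_zero ha hq) ?_
    rw [← add_mul]
    exact mul_ne_zero (fun h => h₂ (eq_neg_of_add_eq_zero_right h)) hq

theorem orbitProj_cosLTwo_apply_eq_zero (hN : groupVN PSL(2, ℚ) DualQuot.measure ≤ P)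
    (hM : P ≤ crossedProduct PSL(2, ℚ) DualQuot.measure) {v : Fin 2 → ℚ} (hv : v ≠ 0)
    {g : PSL(2, ℚ)} (hg : g ≠ 1) : orbitProj P (cosLTwo v) g = 0 := by
  by_contra h
  obtain ⟨a, rfl⟩ := exists_eq_transvection_of_orbitProj_ne_zero hN hM hv h
  have ha : a ≠ 0 := by
    rintro rfl
    exact hg (coe_transvection_zero v)
  refine h ((fourierSupportedOnLine_orbitProj hN hM v a).eq_of_forall_inner_eq
    (fun z _ => inner_zero_right _) hv fun t => ?_)
  rw [inner_cosLTwo_smul_orbitProj hN hM hv, orbitCoeff_eq_zero hN hM ha, inner_zero_right]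

theorem orbitCoeff_functional_equation (hN : groupVN PSL(2, ℚ) DualQuot.measure ≤ P)
    (hM : P ≤ crossedProduct PSL(2, ℚ) DualQuot.measure) {q : ℚ} (hq : q ≠ 0) (s : ℚ) :
    conj (orbitCoeff P 0 (1 / q)) * orbitCoeff P 0 (s / q) =
      conj (orbitCoeff P 0 s) * orbitCoeff P 0 q := by
  obtain ⟨v, w, hvw⟩ : ∃ v w : Fin 2 → ℚ, wedge v w = 1 := ⟨![1, 0], ![0, 1], by simp [wedge]⟩
  have v_eq : v = (-(s / q)) • w + (1 / q) • (q • v + s • w) := by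
    match_scalars <;> field_simp; ring
  have wedge_ne : wedge w (q • v + s • w) ≠ 0 := by
    rw [wedge_add_right, wedge_smul_right, wedge_smul_right, wedge_self, wedge_comm v w, hvw]
    simpa using hq
  have trace_eq := tsum_inner_orbitProj_cosLTwo hN hM v w (q • v + s • w) 1
  have left_eq := tsum_inner_mulLInfty_orbitProj hN hM wedge_ne 0 0 (-(s / q)) (1 / q)
  have right_eq := tsum_inner_mulLInfty_orbitProj hN hM (hvw.trans_ne one_ne_zero) 0 0 q s
  rw [← v_eq] at left_eq
  simp only [coe_transvection_zero, QuotientGroup.mk_one, inv_one, mul_one, orbitCoeff_neg,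
    inner_mulLInfty_cosLInfty, Matrix.SpecialLinearGroup.coe_one, Matrix.one_mulVec]
    at trace_eq left_eq right_eq
  exact mul_left_cancel₀ (inv_ne_zero two_ne_zero)
    (left_eq.symm.trans (trace_eq.trans right_eq))

end Rigidity

/-! ### Maximality -/

section FunctionalEquation

variable {K : Type*} [GroupWithZero K] {m : K → ℝ}

theorem apply_one_div_of_functional_equation (hm_nonneg : ∀ q, 0 ≤ m q)
    (hm : ∀ q s, q ≠ 0 → m (1 / q) * m (s / q) = m s * m q) {q : K} (hq : q ≠ 0) :
    m (1 / q) = m q := by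
  have sq_apply : m (1 / q) * m 1 = m q * m q := by simpa [hq] using hm q q hq
  have sq_apply_one_div : m q * m 1 = m (1 / q) * m (1 / q) := by
    simpa [hq] using hm (1 / q) (1 / q) (one_div_ne_zero hq)
  refine (pow_left_inj₀ (hm_nonneg _) (hm_nonneg _) three_ne_zero).mp ?_
  linear_combination (-m (1 / q)) * sq_apply_one_div + m q * sq_apply

/-- If `m q ≠ 0`, then `m` is a nonzero constant on the powers of `q⁻¹`. -/
theorem eq_zero_of_functional_equation (hm_nonneg : ∀ q, 0 ≤ m q)
    (hm : ∀ q s, q ≠ 0 → m (1 / q) * m (s / q) = m s * m q) (hm_sum : Summable fun q => m q ^ 2)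
    {q : K} (hq : q ≠ 0) (hq_pow : Function.Injective fun n : ℕ => q⁻¹ ^ n) : m q = 0 := by
  by_contra hmq
  have apply_div (s : K) : m (s / q) = m s := by
    have := hm q s hq
    rw [apply_one_div_of_functional_equation hm_nonneg hm hq, mul_comm (m s)] at this
    exact mul_left_cancel₀ hmq this
  have apply_pow (n : ℕ) : m (q⁻¹ ^ n) = m q := by
    induction n with
    | zero => rw [pow_zero, ← div_self hq, apply_div]
    | succ n ih => rw [pow_succ, ← div_eq_mul_inv, apply_div, ih]
  obtain ⟨i, j, hij, pow_eq⟩ := exists_lt_eq_of_summable hm_sum (pow_ne_zero 2 hmq) (q⁻¹ ^ ·)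
    fun n => by rw [apply_pow]
  exact hij.ne (hq_pow pow_eq)

end FunctionalEquation

section Maximality

variable {P : VonNeumannAlgebra (EllTwo PSL(2, ℚ) (Lp ℂ 2 DualQuot.measure))}

theorem orbitCoeff_eq_zero_of_abs_ne_one (hN : groupVN PSL(2, ℚ) DualQuot.measure ≤ P)
    (hM : P ≤ crossedProduct PSL(2, ℚ) DualQuot.measure) {q : ℚ} (hq : |q| ≠ 1) :
    orbitCoeff P 0 q = 0 := by
  rcases eq_or_ne q 0 with rfl | hq₀
  · exact orbitCoeff_zero hN 0
  have abs_pow_injective : Function.Injective fun n : ℕ => |q⁻¹| ^ n :=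
    pow_right_injective₀ (abs_pos.mpr (inv_ne_zero hq₀)) (by rwa [abs_inv, ne_eq, inv_eq_one])
  refine norm_eq_zero.mp (eq_zero_of_functional_equation (m := fun t => ‖orbitCoeff P 0 t‖)
    (fun _ => norm_nonneg _) (fun q s hq => ?_) (summable_norm_sq_orbitCoeff 0) hq₀
    fun i j hij => abs_pow_injective (by simpa only [abs_pow] using congrArg abs hij))
  simpa only [norm_mul, RCLike.norm_conj] using
    congrArg norm (orbitCoeff_functional_equation hN hM hq s)

theorem orbitProj_cosLTwo_eq_smul (hN : groupVN PSL(2, ℚ) DualQuot.measure ≤ P)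
    (hM : P ≤ crossedProduct PSL(2, ℚ) DualQuot.measure) {v : Fin 2 → ℚ} (hv : v ≠ 0) :
    orbitProj P (cosLTwo v) = deltaTensor 1 ((orbitCoeff P 0 1 / 2) • cosLTwo v) := by
  ext1; funext g
  rcases eq_or_ne g 1 with rfl | hg
  · have supported := fourierSupportedOnLine_orbitProj hN hM v 0
    have inner_eq := inner_cosLTwo_smul_orbitProj hN hM hv 0
    rw [coe_transvection_zero] at supported inner_eq
    rw [deltaTensor_self]
    refine supported.eq_of_forall_inner_eq ((fourierSupportedOnLine_cosLTwo v).const_smul _) hv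
      fun t => ?_
    rw [inner_eq, inner_smul_right, inner_cosLTwo_smul_self hv]
    by_cases ht : |t| = 1
    · rcases eq_or_eq_neg_of_abs_eq ht with rfl | rfl
      · norm_num
      · rw [orbitCoeff_neg]
        norm_num
    · rw [orbitCoeff_eq_zero_of_abs_ne_one hN hM ht, if_neg, if_neg, add_zero, mul_zero, mul_zero]
      all_goals
        rintro rfl
        norm_num at ht
  · rw [orbitProj_cosLTwo_apply_eq_zero hN hM hv hg, deltaTensor_of_ne hg]

theorem orbitCoeff_zero_one_eq_zero_or_eq_two (hN : groupVN PSL(2, ℚ) DualQuot.measure ≤ P)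
    (hM : P ≤ crossedProduct PSL(2, ℚ) DualQuot.measure) :
    orbitCoeff P 0 1 = 0 ∨ orbitCoeff P 0 1 = 2 := by
  have hv : (![1, 0] : Fin 2 → ℚ) ≠ 0 := by simp
  have idempotent : orbitProj P ((orbitCoeff P 0 1 / 2) • cosLTwo ![1, 0]) =
      orbitProj P (cosLTwo ![1, 0]) := by
    rw [orbitProj_apply, ← orbitProj_cosLTwo_eq_smul hN hM hv]
    exact Submodule.starProjection_eq_self_iff.mpr (orbitProj_mem _)
  rcases eq_or_ne (orbitProj P (cosLTwo ![1, 0])) 0 with h | h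
  · left
    rw [orbitCoeff, h, lp.coeFn_zero, Pi.zero_apply, inner_zero_right]
  · right
    rw [map_smul] at idempotent
    exact (div_eq_one_iff_eq two_ne_zero).mp
      (smul_left_injective ℂ h (idempotent.trans (one_smul ℂ _).symm))

theorem inner_const_cosLTwo {v : Fin 2 → ℚ} (hv : v ≠ 0) :
    ⟪Lp.const 2 DualQuot.measure (1 : ℂ), cosLTwo v⟫_ℂ = 0 := by
  simpa [cosLTwo_zero, inner_smul_left] using inner_cosLTwo_smul_self hv 0

theorem orbitProj_eq (hN : groupVN PSL(2, ℚ) DualQuot.measure ≤ P)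
    (hM : P ≤ crossedProduct PSL(2, ℚ) DualQuot.measure) (φ : Lp ℂ 2 DualQuot.measure) :
    orbitProj P φ = (orbitCoeff P 0 1 / 2) • deltaTensor 1 φ +
      ((1 - orbitCoeff P 0 1 / 2) * ⟪Lp.const 2 DualQuot.measure (1 : ℂ), φ⟫_ℂ) •
        crossedVector PSL(2, ℚ) DualQuot.measure := by
  set c := orbitCoeff P 0 1 / 2
  suffices orbitProj P = c • deltaTensor 1 + (1 - c) •
      (innerSL ℂ (Lp.const 2 DualQuot.measure (1 : ℂ))).smulRight
        (crossedVector PSL(2, ℚ) DualQuot.measure) by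
    rw [this, mul_smul]
    rfl
  refine ContinuousLinearMap.ext_on dense_span_cosLTwo ?_
  rintro _ ⟨v, rfl⟩
  simp only [add_apply, smul_apply, ContinuousLinearMap.smulRight_apply, innerSL_apply_apply]
  rcases eq_or_ne v 0 with rfl | hv
  · rw [cosLTwo_zero, map_smul, map_smul, orbitProj_const_one, inner_smul_right,
      inner_const_one_self, crossedVector]
    module
  · rw [orbitProj_cosLTwo_eq_smul hN hM hv, inner_const_cosLTwo hv, map_smul, zero_smul, smul_zero,
      add_zero]

theorem eq_groupVN_of_orbitCoeff_eq_zero (hN : groupVN PSL(2, ℚ) DualQuot.measure ≤ P)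
    (hM : P ≤ crossedProduct PSL(2, ℚ) DualQuot.measure) (h : orbitCoeff P 0 1 = 0) :
    P = groupVN PSL(2, ℚ) DualQuot.measure :=
  eq_groupVN_of_orbitProj_eq_smul hN hM fun φ => ⟨_, by
    rw [orbitProj_eq hN hM, h, zero_div, zero_smul, zero_add]⟩

theorem eq_crossedProduct_of_orbitCoeff_eq_two (hN : groupVN PSL(2, ℚ) DualQuot.measure ≤ P)
    (hM : P ≤ crossedProduct PSL(2, ℚ) DualQuot.measure) (h : orbitCoeff P 0 1 = 2) :
    P = crossedProduct PSL(2, ℚ) DualQuot.measure :=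
  eq_crossedProduct_of_orbitProj_eq hN hM fun φ => by
    rw [orbitProj_eq hN hM, h, div_self two_ne_zero, one_smul, sub_self, zero_mul, zero_smul,
      add_zero]

theorem crossedFunction_cosLInfty_notMem_groupVN {v : Fin 2 → ℚ} (hv : v ≠ 0) :
    crossedFunction PSL(2, ℚ) DualQuot.measure (cosLInfty v) ∉
      groupVN PSL(2, ℚ) DualQuot.measure := by
  intro h
  obtain ⟨c, hc⟩ := Submodule.mem_span_singleton.mp
    (mulLInfty_const_mem_span_of_crossedFunction_mem_groupVN h)
  change c • _ = cosLTwo v at hc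
  have c_eq := inner_const_cosLTwo hv
  rw [← hc, inner_smul_right, inner_const_one_self, mul_one] at c_eq
  have inner_self := inner_cosLTwo_smul_self hv 1
  rw [one_smul, ← hc, c_eq, zero_smul, inner_zero_left] at inner_self
  norm_num at inner_self

theorem groupVN_lt_crossedProduct :
    groupVN PSL(2, ℚ) DualQuot.measure < crossedProduct PSL(2, ℚ) DualQuot.measure :=
  SetLike.lt_iff_le_and_exists.mpr ⟨groupVN_le_crossedProduct, _,
    crossedFunction_mem_crossedProduct (cosLInfty ![1, 0]),
    crossedFunction_cosLInfty_notMem_groupVN (by simp)⟩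

end Maximality

end

theorem mainTheorem5 :
    groupVN PSL(2, ℚ) DualQuot.measure < crossedProduct PSL(2, ℚ) DualQuot.measure ∧
    ∀ P : VonNeumannAlgebra (EllTwo PSL(2, ℚ) (Lp ℂ 2 DualQuot.measure)),
      groupVN PSL(2, ℚ) DualQuot.measure ≤ P →
      P ≤ crossedProduct PSL(2, ℚ) DualQuot.measure →
      P = groupVN PSL(2, ℚ) DualQuot.measure ∨
        P = crossedProduct PSL(2, ℚ) DualQuot.measure :=
  ⟨groupVN_lt_crossedProduct, fun _ hN hM =>
    (orbitCoeff_zero_one_eq_zero_or_eq_two hN hM).imp (eq_groupVN_of_orbitCoeff_eq_zero hN hM)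
      (eq_crossedProduct_of_orbitCoeff_eq_two hN hM)⟩
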